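/- Let $d\ge 1$, let $\Omega\subset\mathbb R^d$ be a bounded open set, $T>0$, $\Omega_T=(0,T)\times\Omega$, $m>0$, and set $$\beta(z)=|z|^{m-1}z,\qquad \zeta(z)=\int_0^z\beta(s)\,ds=\frac{|z|^{m+1}}{m+1}\qquad(z\in\mathbb R).$$ Let $u_0\in L^{m+1}(\Omega)$ and $f\in L^2(\Omega_T)$. Let $\Lambda$ map $\Omega\times\mathbb R$ into the symmetric $d\times d$ real matrices, with $\Lambda(x,s)$ measurable in $x$, continuous in $s$, and such that there are $\underline\lambda,\overline\lambda\in(0,\infty)$ with $\underline\lambda|\xi|^2\le\Lambda(x,s)\xi\cdot\xi\le\overline\lambda|\xi|^2$ for all $s\in\mathbb R$, all $\xi\in\mathbb R^d$ and a.e. $x\in\Omega$. A weak solution of $$\partial_t u-\operatorname{div}\big(\Lambda(\cdot,u)\nabla\beta(u)\big)=f\ \text{ in }\Omega_T,\qquad u(0,\cdot)=u_0\ \text{ in }\Omega,\qquad \beta(u)=0\ \text{ on }(0,T)\times\partial\Omega$$ is a function $\bar u:[0,T]\to L^{m+1}(\Omega)$ such that: - $\bar u$ is continuous for the weak topology of $L^{m+1}(\Omega)$,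 and $\bar u(0)=u_0$; - $\beta(\bar u)\in L^2(0,T;H^1_0(\Omega))$ and $\zeta(\bar u)\in L^\infty(0,T;L^1(\Omega))$; - the distributional derivative $\partial_t\bar u$ belongs to $L^2(0,T;H^{-1}(\Omega))$ and, for every $\phi\in L^2(0,T;H^1_0(\Omega))$, $$\int_0^T\langle\partial_t\bar u(t),\phi(t)\rangle_{H^{-1},H^1_0}\,dt+\int_0^T\!\!\int_\Omega\Lambda(x,\bar u)\nabla\beta(\bar u)\cdot\nabla\phi\,dx\,dt=\int_0^T\!\!\int_\Omega f\phi\,dx\,dt .$$ Let $\bar u$ be a weak solution. Then: (i) for every $T_0\in[0,T]$, $$\int_\Omega\zeta(\bar u(T_0,x))\,dx+\int_0^{T_0}\!\!\int_\Omega\Lambda(x,\bar u(t,x))\nabla\beta(\bar u)(t,x)\cdot\nabla\beta(\bar u)(t,x)\,dx\,dt=\int_\Omega\zeta(u_0(x))\,dx+\int_0^{T_0}\!\!\int_\Omega f(t,x)\,\beta(\bar u)(t,x)\,dx\,dt,$$ where all the integrals (in $x$, and then in $t$) converge absolutely; (ii) the function $t\in[0,T]\mapsto\int_\Omega\zeta(\bar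 u(t,x))\,dx\in[0,\infty)$ is continuous and bounded; (iii) $\bar u:[0,T]\to L^{m+1}(\Omega)$ is continuous for the strong topology of $L^{m+1}(\Omega)$. -/

import Mathlib

open MeasureTheory Set
open scoped ENNReal ContDiff

noncomputable section

namespace PorousMedium

/-- The Euclidean space `ℝ^d`. -/
abbrev Space (d : ℕ) : Type := EuclideanSpace ℝ (Fin d)

/-! ### Nonlinearities and exponent -/

/-- `β(z) = |z|^{m-1} z`. -/
def beta (m z : ℝ) : ℝ := |z| ^ (m - 1) * z

/-- `ζ(z) = ∫_0^z β(s) ds = |z|^{m+1} / (m+1)`. -/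
def zeta (m z : ℝ) : ℝ := |z| ^ (m + 1) / (m + 1)

/-- The Lebesgue exponent `m + 1` (for `m ≥ 0`). -/
abbrev expo (m : ℝ) : ℝ≥0∞ := ENNReal.ofReal m + 1

instance instFactOneLeExpo (m : ℝ) : Fact (1 ≤ expo m) := ⟨le_add_self⟩

/-- The Lebesgue space `L^{m+1}(Ω)`. -/
abbrev LSpace {d : ℕ} (Ω : Set (Space d)) (m : ℝ) : Type :=
  Lp ℝ (expo m) (volume.restrict Ω)

/-! ### Test functions, weak gradients, `H^1_0(Ω)` and `H^{-1}(Ω)` -/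

/-- `φ ∈ C_c^∞(U)`. -/
structure IsTest {E : Type*} [NormedAddCommGroup E] [NormedSpace ℝ E] (U : Set E)
    (φ : E → ℝ) : Prop where
  smooth : ContDiff ℝ ∞ φ
  compact : HasCompactSupport φ
  subset : tsupport φ ⊆ U

/-- `g` is a weak gradient of `v` on `Ω`: `∫_Ω v ∇ψ = - ∫_Ω ψ g` for all `ψ ∈ C_c^∞(Ω)`. -/
structure HasWeakGradient {d : ℕ} (Ω : Set (Space d)) (v : Space d → ℝ)
    (g : Space d → Space d) : Prop where
  locInt_fun : LocallyIntegrableOn v Ω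
  locInt_grad : LocallyIntegrableOn g Ω
  eq : ∀ ψ : Space d → ℝ, IsTest Ω ψ →
    ∫ x in Ω, v x • gradient ψ x = - ∫ x in Ω, ψ x • g x

open Classical in
/-- The weak gradient `∇v` on `Ω` (unique up to null sets if it exists; `0` if there is none). -/
def weakGrad {d : ℕ} (Ω : Set (Space d)) (v : Space d → ℝ) : Space d → Space d :=
  if h : ∃ g, HasWeakGradient Ω v g then h.choose else 0

/-- The ambient Hilbert space `L²(Ω) × L²(Ω)^d`, with norm `(‖v‖² + ‖g‖²)^{1/2}`. -/
abbrev GraphSpace {d : ℕ} (Ω : Set (Space d)) : Type :=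
  WithLp 2 (Lp ℝ 2 (volume.restrict Ω) × Lp (Space d) 2 (volume.restrict Ω))

/-- The subspace `{(φ, ∇φ) : φ ∈ C_c^∞(Ω)}`. -/
def testGraph {d : ℕ} (Ω : Set (Space d)) : Submodule ℝ (GraphSpace Ω) where
  carrier := {p | ∃ φ : Space d → ℝ, IsTest Ω φ ∧
    p.fst =ᵐ[volume.restrict Ω] φ ∧ p.snd =ᵐ[volume.restrict Ω] gradient φ}
  zero_mem' := by
    refine ⟨0, ⟨contDiff_const, HasCompactSupport.zero, by simp⟩, Lp.coeFn_zero _ _ _, ?_⟩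
    have h : gradient (0 : Space d → ℝ) = 0 := by
      funext x; simp [gradient]
    rw [h]; exact Lp.coeFn_zero _ _ _
  add_mem' := by
    rintro p q ⟨φ, hφ, h1, h2⟩ ⟨ψ, hψ, k1, k2⟩
    refine ⟨φ + ψ, ⟨hφ.smooth.add hψ.smooth, hφ.compact.add hψ.compact,
      (tsupport_add φ ψ).trans (union_subset hφ.subset hψ.subset)⟩,
      (Lp.coeFn_add _ _).trans (h1.add k1), ?_⟩
    have h : gradient (φ + ψ) = gradient φ + gradient ψ := by
      funext x
      have e := fderiv_add (hφ.smooth.differentiable (by simp) x)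
        (hψ.smooth.differentiable (by simp) x)
      simp [gradient, e]
    rw [h]; exact (Lp.coeFn_add _ _).trans (h2.add k2)
  smul_mem' := by
    rintro c p ⟨φ, hφ, h1, h2⟩
    refine ⟨c • φ, ⟨contDiff_const.smul hφ.smooth, hφ.compact.smul_left,
      (tsupport_smul_subset_right (fun _ => c) φ).trans hφ.subset⟩,
      (Lp.coeFn_smul _ _).trans (h1.const_smul c), ?_⟩
    have h : gradient (c • φ) = c • gradient φ := by
      funext x
      have e := fderiv_const_smul (hφ.smooth.differentiable (by simp) x) c
      simp [gradient, e]
    rw [h]; exact (Lp.coeFn_smul _ _).trans (h2.const_smul c)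

/-- `H^1_0(Ω)`: the closure of `C_c^∞(Ω)` for the `H^1` norm. An element is stored as the pair of
its function and its weak gradient. -/
def H10 {d : ℕ} (Ω : Set (Space d)) : Type := (testGraph Ω).topologicalClosure

instance H10.instNormedAddCommGroup {d : ℕ} (Ω : Set (Space d)) : NormedAddCommGroup (H10 Ω) :=
  inferInstanceAs (NormedAddCommGroup (testGraph Ω).topologicalClosure)

instance H10.instInnerProductSpace {d : ℕ} (Ω : Set (Space d)) : InnerProductSpace ℝ (H10 Ω) :=
  inferInstanceAs (InnerProductSpace ℝ (testGraph Ω).topologicalClosure)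

/-- The inclusion of `H^1_0(Ω)` in `L²(Ω) × L²(Ω)^d`, `w ↦ (w, ∇w)`. -/
def H10.toGraph {d : ℕ} {Ω : Set (Space d)} (w : H10 Ω) : GraphSpace Ω :=
  Subtype.val (p := fun p => p ∈ (testGraph Ω).topologicalClosure) w

/-- The function underlying an element of `H^1_0(Ω)`. -/
def H10.fn {d : ℕ} {Ω : Set (Space d)} (w : H10 Ω) : Lp ℝ 2 (volume.restrict Ω) :=
  w.toGraph.fst

/-- The gradient of an element of `H^1_0(Ω)`. -/
def H10.grad {d : ℕ} {Ω : Set (Space d)} (w : H10 Ω) : Lp (Space d) 2 (volume.restrict Ω) :=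
  w.toGraph.snd

/-- `H^{-1}(Ω)`, the dual of `H^1_0(Ω)`. -/
def HNeg1 {d : ℕ} (Ω : Set (Space d)) : Type := StrongDual ℝ (H10 Ω)

instance HNeg1.instNormedAddCommGroup {d : ℕ} (Ω : Set (Space d)) :
    NormedAddCommGroup (HNeg1 Ω) :=
  inferInstanceAs (NormedAddCommGroup (StrongDual ℝ (H10 Ω)))

instance HNeg1.instNormedSpace {d : ℕ} (Ω : Set (Space d)) : NormedSpace ℝ (HNeg1 Ω) :=
  inferInstanceAs (NormedSpace ℝ (StrongDual ℝ (H10 Ω)))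

/-- The duality pairing `⟨g, w⟩` between `H^{-1}(Ω)` and `H^1_0(Ω)`. -/
def HNeg1.pair {d : ℕ} {Ω : Set (Space d)} (g : HNeg1 Ω) (w : H10 Ω) : ℝ :=
  (show StrongDual ℝ (H10 Ω) from g) w

theorem IsTest.memLp {d : ℕ} {Ω : Set (Space d)} {φ : Space d → ℝ} (h : IsTest Ω φ) :
    MemLp φ 2 (volume.restrict Ω) :=
  h.smooth.continuous.memLp_of_hasCompactSupport h.compact

theorem IsTest.continuous_gradient {d : ℕ} {Ω : Set (Space d)} {φ : Space d → ℝ}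
    (h : IsTest Ω φ) : Continuous (gradient φ) :=
  (LinearIsometryEquiv.continuous _).comp (h.smooth.continuous_fderiv (by simp))

theorem IsTest.compact_gradient {d : ℕ} {Ω : Set (Space d)} {φ : Space d → ℝ}
    (h : IsTest Ω φ) : HasCompactSupport (gradient φ) :=
  (h.compact.fderiv ℝ).comp_left (map_zero _)

theorem IsTest.memLp_gradient {d : ℕ} {Ω : Set (Space d)} {φ : Space d → ℝ} (h : IsTest Ω φ) :
    MemLp (gradient φ) 2 (volume.restrict Ω) :=
  h.continuous_gradient.memLp_of_hasCompactSupport h.compact_gradient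

/-- A test function, as an element of `H^1_0(Ω)`. -/
def H10.ofTest {d : ℕ} {Ω : Set (Space d)} (φ : Space d → ℝ) (h : IsTest Ω φ) : H10 Ω :=
  ⟨WithLp.toLp 2 (h.memLp.toLp φ, h.memLp_gradient.toLp (gradient φ)),
    (testGraph Ω).le_topologicalClosure
      ⟨φ, h, h.memLp.coeFn_toLp, h.memLp_gradient.coeFn_toLp⟩⟩

/-! The gradient stored in an element of `H^1_0(Ω)` is its weak gradient. -/

theorem HasWeakGradient.ae_unique {d : ℕ} {Ω : Set (Space d)} (hΩ : IsOpen Ω)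
    {v w : Space d → ℝ} {g k : Space d → Space d} (hg : HasWeakGradient Ω v g)
    (hk : HasWeakGradient Ω w k) (hvw : v =ᵐ[volume.restrict Ω] w) :
    g =ᵐ[volume.restrict Ω] k := by
  have key : ∀ᵐ x ∂(volume : Measure (Space d)), x ∈ Ω → (g - k) x = 0 := by
    refine hΩ.ae_eq_zero_of_integral_contDiff_smul_eq_zero
      (hg.locInt_grad.sub hk.locInt_grad) fun ψ h1 h2 h3 => ?_
    have hψ : IsTest Ω ψ := ⟨h1, h2, h3⟩
    have e : ∫ x in Ω, v x • gradient ψ x = ∫ x in Ω, w x • gradient ψ x := by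
      refine integral_congr_ae ?_
      filter_upwards [hvw] with x hx
      rw [hx]
    have int : ∀ l : Space d → Space d, LocallyIntegrableOn l Ω →
        IntegrableOn (fun x => ψ x • l x) Ω := by
      intro l hl
      have h := (hl.integrableOn_compact_subset h3 h2).continuousOn_smul
        h1.continuous.continuousOn h2
      refine (integrableOn_iff_integrable_of_support_subset ?_).1 h |>.integrableOn
      intro x hx
      refine subset_tsupport _ ?_
      intro h0
      exact hx (by simp [h0])
    have e' := hg.eq ψ hψ
    rw [e, hk.eq ψ hψ] at e'
    have e2 : ∫ x in Ω, ψ x • (g - k) x = 0 := by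
      simp only [Pi.sub_apply, smul_sub]
      rw [integral_sub (int g hg.locInt_grad) (int k hk.locInt_grad)]
      rw [neg_inj.1 e', sub_self]
    rw [← e2]
    symm
    refine setIntegral_eq_integral_of_forall_compl_eq_zero fun x hx => ?_
    rw [image_eq_zero_of_notMem_tsupport (fun h => hx (h3 h)), zero_smul]
  rw [Filter.EventuallyEq, ae_restrict_iff' hΩ.measurableSet]
  filter_upwards [key] with x hx hxΩ
  exact sub_eq_zero.1 (hx hxΩ)

theorem H10.hasWeakGradient {d : ℕ} {Ω : Set (Space d)} (w : H10 Ω) :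
    HasWeakGradient Ω w.fn w.grad := by
  have loc : ∀ {F : Type} [NormedAddCommGroup F] (l : Lp F 2 (volume.restrict Ω)),
      LocallyIntegrableOn l Ω := by
    intro F _ l
    exact locallyIntegrableOn_of_locallyIntegrable_restrict
      ((Lp.memLp l).locallyIntegrable (by norm_num))
  refine ⟨loc _, loc _, fun ψ hψ => ?_⟩
  have dψ : Differentiable ℝ ψ := hψ.smooth.differentiable (by simp)
  refine ext_inner_left ℝ fun e => ?_
  have mA : MemLp (fun x => inner ℝ e (gradient ψ x)) 2 (volume.restrict Ω) :=
    hψ.memLp_gradient.const_inner e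
  have mB : MemLp (fun x => ψ x • e) 2 (volume.restrict Ω) := by
    refine Continuous.memLp_of_hasCompactSupport (hψ.smooth.continuous.smul continuous_const) ?_
    exact hψ.compact.smul_right
  have hA : ∀ v : Lp ℝ 2 (volume.restrict Ω),
      inner ℝ e (∫ x in Ω, v x • gradient ψ x) = inner ℝ (mA.toLp _) v := by
    intro v
    have hi : Integrable (fun x => v x • gradient ψ x) (volume.restrict Ω) :=
      memLp_one_iff_integrable.1 (hψ.memLp_gradient.smul (Lp.memLp v))
    rw [← integral_inner hi, L2.inner_def]
    refine integral_congr_ae ?_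
    filter_upwards [mA.coeFn_toLp] with x hx
    rw [hx, inner_smul_right]; simp
  have hB : ∀ g : Lp (Space d) 2 (volume.restrict Ω),
      inner ℝ e (∫ x in Ω, ψ x • g x) = inner ℝ (mB.toLp _) g := by
    intro g
    have hi : Integrable (fun x => ψ x • g x) (volume.restrict Ω) :=
      memLp_one_iff_integrable.1 ((Lp.memLp g).smul hψ.memLp)
    rw [← integral_inner hi, L2.inner_def]
    refine integral_congr_ae ?_
    filter_upwards [mB.coeFn_toLp] with x hx
    rw [hx, inner_smul_right, inner_smul_left]; simp
  rw [inner_neg_right, hA, hB]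
  have hcl : IsClosed {p : GraphSpace Ω |
      inner ℝ (mA.toLp _) p.fst = - inner ℝ (mB.toLp _) p.snd} := by
    refine isClosed_eq ?_ ?_ <;> fun_prop
  refine closure_minimal ?_ hcl w.2
  rintro p ⟨φ, hφ, h1, h2⟩
  have dφ : Differentiable ℝ φ := hφ.smooth.differentiable (by simp)
  have vol : ∀ k : Space d → ℝ, (∀ x, x ∉ Ω → k x = 0) → ∫ x in Ω, k x = ∫ x, k x :=
    fun k hk => setIntegral_eq_integral_of_forall_compl_eq_zero hk
  have hgr : ∀ (χ : Space d → ℝ) (x : Space d),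
      inner ℝ e (gradient χ x) = fderiv ℝ χ x e := by
    intro χ x
    rw [real_inner_comm, gradient, InnerProductSpace.toDual_symm_apply]
  have e1 : inner ℝ (mA.toLp _) p.fst = ∫ x, φ x * fderiv ℝ ψ x e := by
    rw [L2.inner_def, ← vol]
    · refine integral_congr_ae ?_
      filter_upwards [mA.coeFn_toLp, h1] with x hx h1x
      rw [hx, h1x, hgr]; simp
    · intro x hx
      rw [image_eq_zero_of_notMem_tsupport (fun h => hx (hφ.subset h)), zero_mul]
  have e2 : inner ℝ (mB.toLp _) p.snd = ∫ x, fderiv ℝ φ x e * ψ x := by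
    rw [L2.inner_def, ← vol]
    · refine integral_congr_ae ?_
      filter_upwards [mB.coeFn_toLp, h2] with x hx h2x
      rw [hx, h2x, inner_smul_left, hgr]; simp [mul_comm]
    · intro x hx
      rw [image_eq_zero_of_notMem_tsupport (fun h => hx (hψ.subset h)), mul_zero]
  have cφ : Continuous fun x => fderiv ℝ φ x e :=
    (hφ.smooth.continuous_fderiv (by simp)).clm_apply continuous_const
  have cψ : Continuous fun x => fderiv ℝ ψ x e :=
    (hψ.smooth.continuous_fderiv (by simp)).clm_apply continuous_const
  change inner ℝ (mA.toLp _) p.fst = - inner ℝ (mB.toLp _) p.snd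
  rw [e1, e2]
  refine integral_mul_fderiv_eq_neg_fderiv_mul_of_integrable ?_ ?_ ?_
    (fun x _ => dφ x) (fun x _ => dψ x)
  · exact (cφ.mul hψ.smooth.continuous).integrable_of_hasCompactSupport hψ.compact.mul_left
  · exact (hφ.smooth.continuous.mul cψ).integrable_of_hasCompactSupport hφ.compact.mul_right
  · exact (hφ.smooth.continuous.mul hψ.smooth.continuous).integrable_of_hasCompactSupport
      hφ.compact.mul_right

theorem weakGrad_ae_eq {d : ℕ} {Ω : Set (Space d)} (hΩ : IsOpen Ω) (w : H10 Ω)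
    {v : Space d → ℝ} (hv : w.fn =ᵐ[volume.restrict Ω] v) :
    weakGrad Ω v =ᵐ[volume.restrict Ω] w.grad := by
  have hw := w.hasWeakGradient
  have hex : ∃ g, HasWeakGradient Ω v g := by
    refine ⟨w.grad, ?_, hw.locInt_grad, fun ψ hψ => ?_⟩
    · exact locallyIntegrableOn_of_locallyIntegrable_restrict
        (((memLp_congr_ae hv).1 (Lp.memLp w.fn)).locallyIntegrable (by norm_num))
    · rw [← hw.eq ψ hψ]
      refine integral_congr_ae ?_
      filter_upwards [hv] with x hx
      rw [hx]
  rw [weakGrad, dif_pos hex]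
  exact hex.choose_spec.ae_unique hΩ hw hv.symm

/-! ### Weak solutions -/

/-- Standing assumptions on the diffusion tensor: symmetric, measurable in `x`, continuous in `s`,
uniformly elliptic and bounded. -/
structure IsDiffusionTensor {d : ℕ} (Ω : Set (Space d))
    (Λ : Space d → ℝ → (Space d →L[ℝ] Space d)) : Prop where
  symm : ∀ x ∈ Ω, ∀ s, (Λ x s : Space d →ₗ[ℝ] Space d).IsSymmetric
  meas : ∀ s, AEStronglyMeasurable (fun x => Λ x s) (volume.restrict Ω)
  cont : ∀ x ∈ Ω, Continuous (Λ x)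
  elliptic : ∃ lam Lam : ℝ, 0 < lam ∧ 0 < Lam ∧ ∀ (s : ℝ) (ξ : Space d),
    ∀ᵐ x ∂(volume.restrict Ω),
      lam * ‖ξ‖ ^ 2 ≤ inner ℝ (Λ x s ξ) ξ ∧ inner ℝ (Λ x s ξ) ξ ≤ Lam * ‖ξ‖ ^ 2

/-- `v : [0,T] → L^{m+1}(Ω)` is continuous for the weak topology of `L^{m+1}(Ω)`. -/
def IsWeaklyContinuous {d : ℕ} (Ω : Set (Space d)) (T m : ℝ) (v : ℝ → LSpace Ω m) : Prop :=
  ContinuousOn (fun t => toWeakSpace ℝ (LSpace Ω m) (v t)) (Icc 0 T)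

/-- `b ∈ L²(0,T;H^1_0(Ω))` and `b(t) = β(u(t))` for a.e. `t`. -/
structure IsBetaOf {d : ℕ} (Ω : Set (Space d)) (T m : ℝ) (u : ℝ → LSpace Ω m)
    (b : ℝ → H10 Ω) : Prop where
  memLp : MemLp b 2 (volume.restrict (Ioo 0 T))
  eq : ∀ᵐ t ∂(volume.restrict (Ioo 0 T)),
    (b t).fn =ᵐ[volume.restrict Ω] fun x => beta m (u t x)

/-- `z ∈ L^∞(0,T;L^1(Ω))` and `z(t) = ζ(u(t))` for a.e. `t`. -/
structure IsZetaOf {d : ℕ} (Ω : Set (Space d)) (T m : ℝ) (u : ℝ → LSpace Ω m)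
    (z : ℝ → Lp ℝ 1 (volume.restrict Ω)) : Prop where
  memLp : MemLp z ∞ (volume.restrict (Ioo 0 T))
  eq : ∀ᵐ t ∂(volume.restrict (Ioo 0 T)),
    z t =ᵐ[volume.restrict Ω] fun x => zeta m (u t x)

/-- `g ∈ L²(0,T;H^{-1}(Ω))` and `g = ∂_t u` in the sense of distributions on `(0,T) × Ω`. -/
structure IsTimeDerivOf {d : ℕ} (Ω : Set (Space d)) (T m : ℝ) (u : ℝ → LSpace Ω m)
    (g : ℝ → HNeg1 Ω) : Prop where
  memLp : MemLp g 2 (volume.restrict (Ioo 0 T))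
  eq : ∀ (θ : ℝ → ℝ) (ψ : Space d → ℝ), IsTest (Ioo 0 T) θ → ∀ hψ : IsTest Ω ψ,
    ∫ t in Ioo 0 T, θ t * (g t).pair (H10.ofTest ψ hψ)
      = - ∫ t in Ioo 0 T, deriv θ t * ∫ x in Ω, u t x * ψ x

/-- `u` is a weak solution of `∂_t u - div(Λ(·,u) ∇β(u)) = f` in `(0,T) × Ω`, `u(0) = u₀`,
`β(u) = 0` on `(0,T) × ∂Ω`. Only the values of `u` on `[0,T]` matter. -/
structure IsWeakSolution {d : ℕ} (Ω : Set (Space d)) (T m : ℝ)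
    (Λ : Space d → ℝ → (Space d →L[ℝ] Space d)) (f : ℝ → Space d → ℝ) (u₀ : LSpace Ω m)
    (u : ℝ → LSpace Ω m) : Prop where
  weakCont : IsWeaklyContinuous Ω T m u
  init : u 0 = u₀
  beta_mem : ∃ b : ℝ → H10 Ω, IsBetaOf Ω T m u b
  zeta_mem : ∃ z : ℝ → Lp ℝ 1 (volume.restrict Ω), IsZetaOf Ω T m u z
  weak_eq : ∃ g : ℝ → HNeg1 Ω, IsTimeDerivOf Ω T m u g ∧
    ∀ φ : ℝ → H10 Ω, MemLp φ 2 (volume.restrict (Ioo 0 T)) →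
      (∫ t in Ioo 0 T, (g t).pair (φ t))
        + (∫ t in Ioo 0 T, ∫ x in Ω, inner ℝ
            (Λ x (u t x) (weakGrad Ω (fun y => beta m (u t y)) x)) ((φ t).grad x))
      = ∫ t in Ioo 0 T, ∫ x in Ω, f t x * (φ t).fn x

/-- `⟨Λ(·,v) ∇β(v), ∇β(v)⟩_{L²(Ω)}`. -/
def dissipation {d : ℕ} (Ω : Set (Space d)) (m : ℝ)
    (Λ : Space d → ℝ → (Space d →L[ℝ] Space d)) (v : LSpace Ω m) : ℝ :=
  ∫ x in Ω, inner ℝ (Λ x (v x) (weakGrad Ω (fun y => beta m (v y)) x))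
    (weakGrad Ω (fun y => beta m (v y)) x)

end PorousMedium

end

noncomputable section

namespace PorousMedium

open Filter Topology

/-! ### An abstract energy identity -/

section Abstract

variable {X : Type*} [NormedAddCommGroup X] [NormedSpace ℝ X]

/-! Formally, testing the equation with `β(u)` and using `d/dt ∫ζ(u) = ⟨∂_t u, β(u)⟩` gives the
energy equality. The chain rule is the difficulty: `u` has a time derivative only in `H^{-1}`, and
`β(u(t))` lies in `H^1_0` only for a.e. `t`.

Convexity of `ζ` replaces differentiation. For a.e. `t` and every `s`, the pairing of `u(s) - u(t) =
∫_t^s ∂_t u` with `β(u(t))` is at most `∫ζ(u(s)) - ∫ζ(u(t))`. Take `s = t + r` and integrate over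
`t`: the right side telescopes to two boundary integrals of length `|r|`. Dividing by `r > 0` and by
`r < 0` gives the two opposite inequalities as `r → 0`. This needs only continuity of translations
in `L²` and lower semicontinuity of the energy at the end points
(`energy_identity_of_subdifferential`).

The convexity inequality requires the `H^{-1}`–`H^1_0` pairing to equal `∫ (u(s) - u(t)) β(u(t))`,
although `u(s) - u(t)` is merely an integrable function. This is `dual_apply_eq_integral`, a
Brezis–Browder type statement proved by truncation and by density of `L²` in `H^{-1}`. The identity
`u(s) - u(t) = ∫_t^s ∂_t u` itself comes from `intervalIntegral_eq_sub_of_distributional`.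

The energy equality exhibits `∫ζ(u)` as a constant plus primitives of integrable functions, so it is
continuous. Weak continuity together with convergence of this energy gives strong continuity;
`tendsto_of_tendsto_integral_zeta` proves this Radon–Riesz property by controlling `|a - b|^{m+1}`
through the Bregman distance of `ζ`. -/

theorem continuous_integral_translate_pairing {g : ℝ → StrongDual ℝ X} {b : ℝ → X}
    (hg : MemLp g 2 volume) (hb : MemLp b 2 volume) :
    Continuous fun y : ℝ => ∫ t, g (y + t) (b t) := by
  have : Fact ((2 : ℝ≥0∞) ≠ ⊤) := ⟨by norm_num⟩
  -- Continuity of translations in `L²` carries the statement; Hölder's pairing with the fixed `b`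
  -- does the rest.
  have h1 : Continuous fun y : ℝ => (DomAddAct.mk y) +ᵥ (hg.toLp g) :=
    DomAddAct.continuous_mk.vadd continuous_const
  have h2 : Continuous fun y : ℝ =>
      (ContinuousLinearMap.id ℝ (StrongDual ℝ X)).lpPairing volume 2 2
        ((DomAddAct.mk y) +ᵥ (hg.toLp g)) (hb.toLp b) :=
    (((ContinuousLinearMap.id ℝ (StrongDual ℝ X)).lpPairing volume 2 2).continuous.comp
      h1).clm_apply continuous_const
  refine h2.congr fun y => ?_
  rw [ContinuousLinearMap.lpPairing_eq_integral]
  refine integral_congr_ae ?_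
  rw [DomAddAct.mk_vadd_toLp]
  filter_upwards [MemLp.coeFn_toLp
    (hg.comp_measurePreserving (measurePreserving_vadd y volume)), hb.coeFn_toLp] with t h3 h4
  rw [h4]
  exact congrArg (fun L : StrongDual ℝ X => L (b t)) h3

/-- Up to reflecting `b`, this is the integrand of a convolution of two `L¹` functions. It justifies
Fubini in the shift and time variables. -/
theorem integrable_pairing_translate {g : ℝ → StrongDual ℝ X} {b : ℝ → X}
    (hg : Integrable g) (hb : Integrable b) :
    Integrable (fun p : ℝ × ℝ => g (p.1 + p.2) (b p.2)) (volume.prod volume) := by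
  have h := (hb.comp_neg).convolution_integrand
    (ContinuousLinearMap.id ℝ (StrongDual ℝ X)).flip hg
  have e : MeasurePreserving (fun p : ℝ × ℝ => (p.1, -p.2)) (volume.prod volume)
      (volume.prod volume) :=
    (MeasurePreserving.id volume).prod (Measure.measurePreserving_neg volume)
  have h' := e.integrable_comp_of_integrable h
  refine h'.congr (Eventually.of_forall fun p => ?_)
  simp

/-- Freezing `E` at its end-point values makes `E (t + r)` meaningful for every shift `r`, and turns
the boundary integrals into exact multiples of `E 0` and `E T`. -/
theorem intervalIntegrable_comp_clamp {E : ℝ → ℝ} {T : ℝ} (hT : 0 < T)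
    (hE : IntegrableOn E (Ioo 0 T)) (a c : ℝ) :
    IntervalIntegrable (fun s => E (max 0 (min T s))) volume a c := by
  have e : (fun s => E (max 0 (min T s))) =
      (Icc 0 T).indicator E + ((Iio 0).indicator (fun _ => E 0) +
        (Ioi T).indicator (fun _ => E T)) := by
    funext s
    rcases lt_or_ge s 0 with h | h
    · simp [h, h.not_ge, (h.trans hT).le, h.le, (h.trans hT).not_gt]
    · rcases lt_or_ge T s with h' | h'
      · simp [h', h'.not_ge, h'.le, hT.le, h.not_gt]
      · simp [h, h', h.not_gt, h'.not_gt]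
  rw [e]
  have hE' : IntegrableOn E (Icc 0 T) :=
    (integrableOn_Icc_iff_integrableOn_Ioo (by finiteness) (by finiteness)).2 hE
  refine ((integrable_indicator_iff measurableSet_Icc).2 hE').intervalIntegrable.add
    (IntervalIntegrable.add ?_ ?_)
  · exact (((locallyIntegrable_const (E 0)).indicator measurableSet_Iio).integrableOn_isCompact
      isCompact_uIcc).intervalIntegrable
  · exact (((locallyIntegrable_const (E T)).indicator measurableSet_Ioi).integrableOn_isCompact
      isCompact_uIcc).intervalIntegrable

/-- The zero extension of `g` contributes nothing beyond `(0, T)`, so a shifted end point may be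
replaced by its projection onto `[0, T]`, where the subdifferential inequality is available. -/
theorem intervalIntegral_indicator_eq_clamp {Y : Type*} [NormedAddCommGroup Y] [NormedSpace ℝ Y]
    {g : ℝ → Y} {T t : ℝ} (ht : t ∈ Ioo 0 T) (hg : Integrable ((Ioo 0 T).indicator g)) (r : ℝ) :
    ∫ τ in t..r, (Ioo 0 T).indicator g τ = ∫ τ in t..(max 0 (min T r)), g τ := by
  have hT : 0 < T := ht.1.trans ht.2
  rw [← intervalIntegral.integral_add_adjacent_intervals (b := max 0 (min T r))
    hg.intervalIntegrable hg.intervalIntegrable]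
  have z : ∫ τ in (max 0 (min T r))..r, (Ioo 0 T).indicator g τ = 0 := by
    refine (intervalIntegral.integral_congr_ae (g := fun _ => 0)
      (Eventually.of_forall fun x hx => ?_)).trans (by simp)
    refine indicator_of_notMem ?_ _
    rintro ⟨h1, h2⟩
    rcases lt_or_ge r 0 with h | h
    · rw [min_eq_right (h.le.trans hT.le), max_eq_left h.le, uIoc_of_ge h.le] at hx
      exact absurd h1 hx.2.not_gt
    · rcases lt_or_ge T r with h' | h'
      · rw [min_eq_left h'.le, max_eq_right hT.le, uIoc_of_le h'.le] at hx
        exact absurd h2 hx.1.not_gt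
      · rw [min_eq_right h', max_eq_right h] at hx
        simp at hx
  rw [z, add_zero]
  refine intervalIntegral.integral_congr_ae ?_
  -- The half-open interval of integration can contain `T`, which `Ioo 0 T` omits; one point is
  -- negligible.
  filter_upwards [Measure.ae_ne volume T] with x hxT hx
  refine indicator_of_mem ?_ _
  have h0 : 0 ≤ max 0 (min T r) := le_max_left _ _
  have h1 : max 0 (min T r) ≤ T := max_le hT.le (min_le_left _ _)
  rw [mem_uIoc] at hx
  rcases hx with hx | hx
  · exact ⟨ht.1.trans hx.1, lt_of_le_of_ne (hx.2.trans h1) hxT⟩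
  · exact ⟨h0.trans_lt hx.1, hx.2.trans_lt ht.2⟩

theorem memLp_indicator_Ioo {Y : Type*} [NormedAddCommGroup Y] {T : ℝ} {g : ℝ → Y}
    (hg : MemLp g 2 (volume.restrict (Ioo 0 T))) : MemLp ((Ioo 0 T).indicator g) 2 volume :=
  (memLp_indicator_iff_restrict measurableSet_Ioo).2 hg

theorem integrable_indicator_Ioo {Y : Type*} [NormedAddCommGroup Y] {T : ℝ} {g : ℝ → Y}
    (hg : MemLp g 2 (volume.restrict (Ioo 0 T))) : Integrable ((Ioo 0 T).indicator g) :=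
  (integrable_indicator_iff measurableSet_Ioo).2 (hg.integrable (by norm_num))

/-- The subdifferential inequality between `t` and the projection of `t + r` is integrated over `t`.
By translation, the right side reduces to what enters past `T` minus what leaves near `0`. Both
signs of `r` are allowed, which later yields both halves of an equality. -/
theorem integral_pairing_le_of_subdifferential {T : ℝ} (hT : 0 < T) {g : ℝ → StrongDual ℝ X}
    {b : ℝ → X} (hg : Integrable ((Ioo 0 T).indicator g)) (hb : Integrable ((Ioo 0 T).indicator b))
    {E : ℝ → ℝ} (hE : IntegrableOn E (Ioo 0 T))
    (h : ∀ᵐ t ∂(volume.restrict (Ioo 0 T)), ∀ s ∈ Icc 0 T,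
      (∫ τ in t..s, g τ) (b t) ≤ E s - E t) (r : ℝ) :
    ∫ y in 0..r, ∫ t, (Ioo 0 T).indicator g (y + t) ((Ioo 0 T).indicator b t)
      ≤ (∫ s in T..(T + r), E (max 0 (min T s))) - ∫ s in 0..r, E (max 0 (min T s)) := by
  set G := (Ioo 0 T).indicator g with hG
  set B := (Ioo 0 T).indicator b with hB
  set F : ℝ → ℝ := fun s => E (max 0 (min T s)) with hF
  have Fi : ∀ a c, IntervalIntegrable F volume a c := intervalIntegrable_comp_clamp hT hE
  have FI := integrable_pairing_translate hg hb
  have sw : ∫ y in 0..r, ∫ t, G (y + t) (B t) = ∫ t, ∫ y in 0..r, G (y + t) (B t) := by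
    refine intervalIntegral_integral_swap (f := fun y t => G (y + t) (B t)) ?_
    exact FI.mono_measure (Measure.prod_mono Measure.restrict_le_self le_rfl)
  have sw' : ∫ y in 0..r, ∫ t, G (y + t) (B t) = ∫ t in Ioo 0 T, ∫ y in 0..r, G (y + t) (B t) := by
    rw [sw, setIntegral_eq_integral_of_forall_compl_eq_zero]
    intro t ht
    simp [hB, indicator_of_notMem ht]
  have it : Integrable (fun t => ∫ y in 0..r, G (y + t) (B t)) := by
    simp only [intervalIntegral.intervalIntegral_eq_integral_uIoc]
    simp only [smul_eq_mul]
    refine Integrable.const_mul ?_ _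
    exact Integrable.integral_prod_right (f := fun p : ℝ × ℝ => G (p.1 + p.2) (B p.2))
      (FI.mono_measure (Measure.prod_mono Measure.restrict_le_self le_rfl))
  have i1 : IntervalIntegrable (fun t => F (t + r)) volume 0 T := by
    have := (Fi r (T + r)).comp_add_right r
    simpa using this
  have e : ∫ t in Ioo 0 T, (F (t + r) - F t)
      = (∫ s in T..(T + r), F s) - ∫ s in 0..r, F s := by
    rw [← integral_Ioc_eq_integral_Ioo, ← intervalIntegral.integral_of_le hT.le,
      intervalIntegral.integral_sub i1 (Fi 0 T), intervalIntegral.integral_comp_add_right,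
      zero_add]
    have := intervalIntegral.integral_interval_sub_interval_comm (Fi r (T + r)) (Fi 0 T)
      (Fi r 0)
    rw [this, intervalIntegral.integral_symm 0 r, intervalIntegral.integral_symm T (T + r)]
    ring
  rw [sw', ← e]
  refine integral_mono_ae it.integrableOn ?_ ?_
  · exact ((i1.sub (Fi 0 T)).1).mono_set Ioo_subset_Ioc_self
  · filter_upwards [h, self_mem_ae_restrict measurableSet_Ioo] with t h1 ht
    have h2 := h1 (max 0 (min T (t + r))) ⟨le_max_left _ _, max_le hT.le (min_le_left _ _)⟩
    have e1 : ∫ y in 0..r, G (y + t) (B t) = (∫ τ in t..(max 0 (min T (t + r))), g τ) (b t) := by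
      rw [← intervalIntegral_indicator_eq_clamp ht hg]
      have : ∫ τ in t..(t + r), G τ = ∫ y in 0..r, G (y + t) := by
        rw [intervalIntegral.integral_comp_add_right, zero_add, add_comm r]
      have ib : IntervalIntegrable (fun y => G (y + t)) volume 0 r :=
        (hg.comp_add_right t).intervalIntegrable
      rw [← hG, this, ContinuousLinearMap.intervalIntegral_apply ib]
      simp only [hB, indicator_of_mem ht]
    change ∫ y in 0..r, G (y + t) (B t) ≤ F (t + r) - F t
    have e2 : F t = E t := by
      simp only [hF]; rw [min_eq_right ht.2.le, max_eq_right ht.1.le]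
    rw [e1, e2]
    exact h2

/-- If `g` plays the role of the derivative of a curve along which a convex functional takes the
values `E`, with `b` in its subdifferential, then `E T - E 0 = ∫ ⟨g, b⟩`. -/
theorem energy_identity_of_subdifferential {T : ℝ} (hT : 0 < T) {g : ℝ → StrongDual ℝ X}
    {b : ℝ → X} (hg : MemLp g 2 (volume.restrict (Ioo 0 T)))
    (hb : MemLp b 2 (volume.restrict (Ioo 0 T))) {E : ℝ → ℝ} (hE : IntegrableOn E (Ioo 0 T))
    (lsc₀ : ∀ ε > 0, ∀ᶠ t in 𝓝[>] (0 : ℝ), E 0 - ε ≤ E t)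
    (lscT : ∀ ε > 0, ∀ᶠ t in 𝓝[<] T, E T - ε ≤ E t)
    (h : ∀ᵐ t ∂(volume.restrict (Ioo 0 T)), ∀ s ∈ Icc 0 T,
      (∫ τ in t..s, g τ) (b t) ≤ E s - E t) :
    E T - E 0 = ∫ t in Ioo 0 T, g t (b t) := by
  set G := (Ioo 0 T).indicator g with hG
  set B := (Ioo 0 T).indicator b with hB
  set F : ℝ → ℝ := fun s => E (max 0 (min T s)) with hF
  have G2 : MemLp G 2 volume := memLp_indicator_Ioo hg
  have B2 : MemLp B 2 volume := memLp_indicator_Ioo hb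
  have G1 : Integrable G := integrable_indicator_Ioo hg
  have B1 : Integrable B := integrable_indicator_Ioo hb
  have Fi : ∀ a c, IntervalIntegrable F volume a c := intervalIntegrable_comp_clamp hT hE
  have F_mem : ∀ s ∈ Icc 0 T, F s = E s := fun s hs => by
    simp only [hF]; rw [min_eq_right hs.2, max_eq_right hs.1]
  have F_le : ∀ s ≤ 0, F s = E 0 := fun s hs => by
    simp only [hF]; rw [min_eq_right (hs.trans hT.le), max_eq_left hs]
  have F_ge : ∀ s, T ≤ s → F s = E T := fun s hs => by
    simp only [hF]; rw [min_eq_left hs, max_eq_right hT.le]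
  set φ : ℝ → ℝ := fun y => ∫ t, G (y + t) (B t) with hφ
  have φc : Continuous φ := continuous_integral_translate_pairing G2 B2
  have φ0 : φ 0 = ∫ t in Ioo 0 T, g t (b t) := by
    rw [← integral_indicator measurableSet_Ioo]
    refine integral_congr_ae (Eventually.of_forall fun t => ?_)
    by_cases ht : t ∈ Ioo 0 T
    · simp only [hG, hB, zero_add, indicator_of_mem ht]
    · simp only [hG, hB, indicator_of_notMem ht, map_zero]
  have key : ∀ r : ℝ, ∫ y in 0..r, φ y ≤ (∫ s in T..(T + r), F s) - ∫ s in 0..r, F s :=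
    integral_pairing_le_of_subdifferential hT G1 B1 hE h
  have der : HasDerivAt (fun r => ∫ y in 0..r, φ y) (φ 0) 0 :=
    φc.integral_hasStrictDerivAt 0 0 |>.hasDerivAt
  rw [← φ0]
  refine le_antisymm ?_ ?_
  -- Negative shifts: division by `r` reverses the inequality and gives the upper bound for `E T - E
  -- 0`. To the left of `0` the frozen energy is exactly `E 0`, so only semicontinuity at `T` is
  -- used.
  · refine le_of_forall_pos_le_add fun ε hε => ?_
    have lim := der.tendsto_slope_zero_left
    simp only [zero_add, intervalIntegral.integral_same, sub_zero, smul_eq_mul] at lim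
    rw [← sub_le_iff_le_add]
    refine ge_of_tendsto lim ?_
    obtain ⟨a, ha, hav⟩ := mem_nhdsLT_iff_exists_Ioo_subset.1 (lscT ε hε)
    have m1 : ∀ᶠ r : ℝ in 𝓝[<] 0, max a 0 - T < r :=
      (eventually_gt_nhds (by simpa using ⟨ha, hT⟩)).filter_mono nhdsWithin_le_nhds
    filter_upwards [m1, self_mem_nhdsWithin] with r hr1 hr2
    have hr2 : r < 0 := hr2
    have k := key r
    have e1 : ∫ s in 0..r, F s = r * E 0 := by
      rw [intervalIntegral.integral_congr (g := fun _ => E 0)]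
      · simp
      · intro s hs
        rw [uIcc_of_ge hr2.le] at hs
        exact F_le s hs.2
    have e2 : -r * (E T - ε) ≤ ∫ s in (T + r)..T, F s := by
      have : ∫ s in (T + r)..T, (E T - ε) = -r * (E T - ε) := by simp; ring
      rw [← this]
      refine intervalIntegral.integral_mono_on_of_le_Ioo (by linarith) (by simp) (Fi _ _) ?_
      intro s hs
      have h0 : max a 0 < s := by linarith [hs.1]
      rw [F_mem s ⟨(le_max_right _ _).trans h0.le, hs.2.le⟩]
      exact hav ⟨(le_max_left _ _).trans_lt h0, hs.2⟩
    rw [intervalIntegral.integral_symm (T + r) T, e1] at k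
    rw [← div_eq_inv_mul, le_div_iff_of_neg hr2]
    nlinarith
  -- Positive shifts give the lower bound for `E T - E 0`; now the energy beyond `T` is exactly `E
  -- T`, and semicontinuity at `0` is used.
  · refine le_of_forall_pos_le_add fun ε hε => ?_
    have lim := der.tendsto_slope_zero_right
    simp only [zero_add, intervalIntegral.integral_same, sub_zero, smul_eq_mul] at lim
    refine le_of_tendsto lim ?_
    obtain ⟨a, ha, hav⟩ := mem_nhdsGT_iff_exists_Ioo_subset.1 (lsc₀ ε hε)
    have m1 : ∀ᶠ r : ℝ in 𝓝[>] 0, r < min a T :=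
      (eventually_lt_nhds (lt_min ha hT)).filter_mono nhdsWithin_le_nhds
    filter_upwards [m1, self_mem_nhdsWithin] with r hr1 hr2
    have hr2 : 0 < r := hr2
    have k := key r
    have e1 : ∫ s in T..(T + r), F s = r * E T := by
      rw [intervalIntegral.integral_congr (g := fun _ => E T)]
      · simp
      · intro s hs
        rw [uIcc_of_le (by linarith)] at hs
        exact F_ge s hs.1
    have e2 : r * (E 0 - ε) ≤ ∫ s in 0..r, F s := by
      have : ∫ s in 0..r, (E 0 - ε) = r * (E 0 - ε) := by simp; ring
      rw [← this]
      refine intervalIntegral.integral_mono_on_of_le_Ioo hr2.le (by simp) (Fi _ _) ?_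
      intro s hs
      have h0 : s < min a T := by linarith [hs.2]
      rw [F_mem s ⟨hs.1.le, (h0.trans_le (min_le_right _ _)).le⟩]
      exact hav ⟨hs.1, h0.trans_le (min_le_left _ _)⟩
    rw [e1] at k
    rw [← div_eq_inv_mul, div_le_iff₀ hr2]
    nlinarith

end Abstract

/-! ### The scalar nonlinearities -/

theorem beta_eq {m : ℝ} (hm : 0 < m) (z : ℝ) :
    beta m z = (max z 0) ^ m - (max (-z) 0) ^ m := by
  unfold beta
  rcases lt_trichotomy z 0 with h | h | h
  · rw [max_eq_right h.le, max_eq_left (by linarith), abs_of_neg h, Real.zero_rpow hm.ne',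
      Real.rpow_sub_one (by linarith)]
    have := h.ne
    field_simp
    ring
  · subst h; simp
  · rw [max_eq_left h.le, max_eq_right (by linarith), abs_of_pos h, Real.zero_rpow hm.ne',
      Real.rpow_sub_one h.ne']
    field_simp
    ring

theorem continuous_beta {m : ℝ} (hm : 0 < m) : Continuous (beta m) := by
  have e : beta m = fun z => (max z 0) ^ m - (max (-z) 0) ^ m := funext (beta_eq hm)
  rw [e]
  exact ((continuous_id.max continuous_const).rpow_const fun _ => Or.inr hm.le).sub
    ((continuous_neg.max continuous_const).rpow_const fun _ => Or.inr hm.le)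

theorem continuous_zeta {m : ℝ} (hm : 0 < m) : Continuous (zeta m) :=
  (continuous_abs.rpow_const fun _ => Or.inr (by linarith)).div_const _

theorem abs_beta {m : ℝ} (hm : 0 < m) (z : ℝ) : |beta m z| = |z| ^ m := by
  rcases eq_or_ne z 0 with h | h
  · simp [h, beta, Real.zero_rpow hm.ne']
  · have h' : |z| ≠ 0 := abs_ne_zero.2 h
    rw [beta, abs_mul, abs_of_nonneg (by positivity), Real.rpow_sub_one h']
    field_simp

theorem beta_inv_beta {m : ℝ} (hm : 0 < m) (z : ℝ) : beta m⁻¹ (beta m z) = z := by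
  rcases eq_or_ne z 0 with h | h
  · simp [h, beta]
  · have h' : 0 < |z| := abs_pos.2 h
    have e : |beta m z| ^ (m⁻¹ - 1) * |z| ^ (m - 1) = 1 := by
      rw [abs_beta hm, ← Real.rpow_mul h'.le, ← Real.rpow_add h']
      have : m * (m⁻¹ - 1) + (m - 1) = 0 := by field_simp; ring
      rw [this, Real.rpow_zero]
    calc beta m⁻¹ (beta m z) = |beta m z| ^ (m⁻¹ - 1) * (|z| ^ (m - 1) * z) := rfl
      _ = (|beta m z| ^ (m⁻¹ - 1) * |z| ^ (m - 1)) * z := by ring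
      _ = z := by rw [e, one_mul]

/-- A substitute for Young's inequality: replace the smaller of `|a|`, `|b|` by the larger. -/
theorem abs_beta_mul_le {m : ℝ} (hm : 0 < m) (a b : ℝ) :
    |beta m b * a| ≤ |a| ^ (m + 1) + |b| ^ (m + 1) := by
  rw [abs_mul, abs_beta hm]
  have ha := abs_nonneg a
  have hb := abs_nonneg b
  rcases le_total |a| |b| with h | h
  · calc |b| ^ m * |a| ≤ |b| ^ m * |b| := by gcongr
      _ = |b| ^ (m + 1) := by rw [Real.rpow_add_one' hb (by linarith)]
      _ ≤ _ := le_add_of_nonneg_left (by positivity)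
  · calc |b| ^ m * |a| ≤ |a| ^ m * |a| := by gcongr
      _ = |a| ^ (m + 1) := by rw [Real.rpow_add_one' ha (by linarith)]
      _ ≤ _ := le_add_of_nonneg_right (by positivity)

/-- The Bregman distance `ζ(a) - ζ(b) - β(b)(a - b)` of the convex function `ζ`. -/
def bregman (m a b : ℝ) : ℝ := zeta m a - zeta m b - beta m b * (a - b)

/-- Homogeneity of degree `m + 1` reduces two-variable estimates to one variable with base point
`1`. -/
theorem bregman_mul {m : ℝ} {b : ℝ} (hb : b ≠ 0) (x : ℝ) :
    bregman m (b * x) b = |b| ^ (m + 1) * bregman m x 1 := by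
  have h' : 0 < |b| := abs_pos.2 hb
  have e : |b| ^ (m - 1) * b * (b * x - b) = |b| ^ (m + 1) * (x - 1) := by
    have : |b| ^ (m + 1) = |b| ^ (m - 1) * b ^ 2 := by
      rw [← sq_abs, ← Real.rpow_natCast |b| 2, ← Real.rpow_add h']
      norm_num; congr 1; ring
    rw [this]; ring
  simp only [bregman, zeta, beta, e, abs_mul, Real.mul_rpow (abs_nonneg b) (abs_nonneg x)]
  simp
  ring

/-- For `x ≥ 0` this is the strict Bernoulli inequality; for `x < 0` the tangent line to `|x| ^ (m +
1)` at `1` is already negative. -/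
theorem bregman_one_pos {m : ℝ} (hm : 0 < m) {x : ℝ} (hx : x ≠ 1) : 0 < bregman m x 1 := by
  have e : bregman m x 1 = (|x| ^ (m + 1) - (1 + (m + 1) * (x - 1))) / (m + 1) := by
    simp only [bregman, zeta, beta]
    simp
    field_simp
    ring
  rw [e]
  refine div_pos ?_ (by linarith)
  rcases le_or_gt 0 x with h | h
  · have := one_add_mul_self_lt_rpow_one_add (s := x - 1) (by linarith) (sub_ne_zero.2 hx)
      (p := m + 1) (by linarith)
    rw [abs_of_nonneg h]
    rw [add_sub_cancel] at this
    linarith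
  · have : 0 ≤ |x| ^ (m + 1) := by positivity
    nlinarith

theorem bregman_zero {m : ℝ} (hm : 0 < m) (a : ℝ) : bregman m a 0 = zeta m a := by
  have : m + 1 ≠ 0 := by linarith
  simp [bregman, zeta, beta, Real.zero_rpow this]

theorem bregman_nonneg {m : ℝ} (hm : 0 < m) (a b : ℝ) : 0 ≤ bregman m a b := by
  rcases eq_or_ne b 0 with rfl | hb
  · rw [bregman_zero hm]; unfold zeta; positivity
  · have e : a = b * (a / b) := by field_simp
    rw [e, bregman_mul hb]
    refine mul_nonneg (by positivity) ?_
    rcases eq_or_ne (a / b) 1 with h | h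
    · rw [h]; simp [bregman]
    · exact (bregman_one_pos hm h).le

/-- Both sides grow like `|x| ^ (m + 1)` at infinity, and away from `x = 1` on a compact set their
ratio is bounded. The term `ε` covers a neighbourhood of `1`: when `m < 1` the Bregman distance is
quadratic there and cannot dominate the power `m + 1 < 2`. -/
theorem exists_abs_sub_one_rpow_le {m : ℝ} (hm : 0 < m) {ε : ℝ} (hε : 0 < ε) :
    ∃ C : ℝ, ∀ x : ℝ, |x - 1| ^ (m + 1) ≤ C * bregman m x 1 + ε := by
  have hp : 0 < m + 1 := by linarith
  have kc : Continuous fun x => bregman m x 1 := by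
    have := continuous_zeta hm
    unfold bregman
    fun_prop
  have pc : Continuous fun x : ℝ => |x - 1| ^ (m + 1) :=
    (continuous_id.sub continuous_const).abs.rpow_const fun _ => Or.inr hp.le
  -- This threshold makes `|x| ^ (m + 1) ≥ 2 * (m + 1) * |x|`, so one of the two copies of `|x| ^ (m
  -- + 1)` in `2 * (m + 1) * bregman m x 1` absorbs the linear term.
  obtain ⟨R, hR1, hR⟩ : ∃ R : ℝ, 1 ≤ R ∧ ∀ r, R ≤ r → 2 * (m + 1) ≤ r ^ m := by
    obtain ⟨R, hR⟩ := eventually_atTop.1 ((tendsto_rpow_atTop hm).eventually_ge_atTop (2 * (m + 1)))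
    exact ⟨max 1 R, le_max_left _ _, fun r hr => hR r ((le_max_right _ _).trans hr)⟩
  have big : ∀ x : ℝ, R ≤ |x| →
      |x - 1| ^ (m + 1) ≤ (2 ^ (m + 1) * (2 * (m + 1))) * bregman m x 1 := by
    intro x hx
    have h1 : 1 ≤ |x| := hR1.trans hx
    have h2 : |x - 1| ≤ 2 * |x| := by
      calc |x - 1| ≤ |x| + |1| := abs_sub x 1
        _ ≤ 2 * |x| := by rw [abs_one]; linarith
    have h3 : |x - 1| ^ (m + 1) ≤ 2 ^ (m + 1) * |x| ^ (m + 1) := by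
      rw [← Real.mul_rpow (by norm_num) (abs_nonneg x)]
      gcongr
    have h4 : |x| ^ (m + 1) ≤ 2 * (m + 1) * bregman m x 1 := by
      have h5 : 2 * (m + 1) * |x| ≤ |x| ^ (m + 1) := by
        rw [Real.rpow_add_one (by linarith)]
        have := hR _ hx
        gcongr
      have h6 : bregman m x 1 = |x| ^ (m + 1) / (m + 1) - 1 / (m + 1) - (x - 1) := by
        simp [bregman, zeta, beta]
      rw [h6]
      have h7 : 2 * (m + 1) * (|x| ^ (m + 1) / (m + 1) - 1 / (m + 1) - (x - 1))
          = 2 * |x| ^ (m + 1) - 2 * (m + 1) * x + 2 * m := by field_simp; ring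
      rw [h7]
      nlinarith [le_abs_self x]
    calc |x - 1| ^ (m + 1) ≤ 2 ^ (m + 1) * |x| ^ (m + 1) := h3
      _ ≤ 2 ^ (m + 1) * (2 * (m + 1) * bregman m x 1) := by gcongr
      _ = _ := by ring
  have nn : ∀ x, 0 ≤ bregman m x 1 := fun x => bregman_nonneg hm x 1
  obtain ⟨C', hC'⟩ : ∃ C' : ℝ, ∀ x : ℝ, |x| ≤ R → |x - 1| ^ (m + 1) ≤ C' * bregman m x 1 + ε := by
    have cS : IsCompact {x : ℝ | |x| ≤ R ∧ ε ≤ |x - 1| ^ (m + 1)} := by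
      have : {x : ℝ | |x| ≤ R ∧ ε ≤ |x - 1| ^ (m + 1)} =
          Icc (-R) R ∩ {x | ε ≤ |x - 1| ^ (m + 1)} := by
        ext x; simp [abs_le]
      rw [this]
      exact isCompact_Icc.inter_right (isClosed_le continuous_const pc)
    have ne : ∀ x ∈ {x : ℝ | |x| ≤ R ∧ ε ≤ |x - 1| ^ (m + 1)}, bregman m x 1 ≠ 0 := by
      rintro x ⟨-, hx⟩
      refine (bregman_one_pos hm ?_).ne'
      rintro rfl
      rw [sub_self, abs_zero, Real.zero_rpow hp.ne'] at hx
      linarith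
    obtain ⟨C, hC⟩ := cS.exists_bound_of_continuousOn
      (f := fun x => |x - 1| ^ (m + 1) / bregman m x 1) (pc.continuousOn.div kc.continuousOn ne)
    refine ⟨max C 0, fun x hx => ?_⟩
    rcases le_or_gt ε (|x - 1| ^ (m + 1)) with h | h
    · have h1 := (le_abs_self _).trans (hC x ⟨hx, h⟩)
      have h2 : 0 < bregman m x 1 := lt_of_le_of_ne (nn x) (ne x ⟨hx, h⟩).symm
      rw [div_le_iff₀ h2] at h1
      have : C * bregman m x 1 ≤ max C 0 * bregman m x 1 := by
        gcongr; exact le_max_left _ _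
      linarith
    · have : 0 ≤ max C 0 * bregman m x 1 := mul_nonneg (le_max_right _ _) (nn x)
      linarith
  refine ⟨max C' (2 ^ (m + 1) * (2 * (m + 1))), fun x => ?_⟩
  rcases le_total |x| R with h | h
  · refine (hC' x h).trans ?_
    gcongr
    · exact nn x
    · exact le_max_left _ _
  · refine (big x h).trans ?_
    have : (2 ^ (m + 1) * (2 * (m + 1))) * bregman m x 1 ≤
        max C' (2 ^ (m + 1) * (2 * (m + 1))) * bregman m x 1 := by
      gcongr
      · exact nn x
      · exact le_max_right _ _
    linarith

theorem exists_abs_sub_rpow_le {m : ℝ} (hm : 0 < m) {ε : ℝ} (hε : 0 < ε) :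
    ∃ C : ℝ, 0 ≤ C ∧ ∀ a b : ℝ, |a - b| ^ (m + 1) ≤ C * bregman m a b + ε * |b| ^ (m + 1) := by
  obtain ⟨C, hC⟩ := exists_abs_sub_one_rpow_le hm hε
  -- The value `m + 1` serves the case `b = 0`, where scaling is impossible and the Bregman distance
  -- is `ζ(a)`.
  refine ⟨max C (m + 1), le_max_of_le_right (by linarith), fun a b => ?_⟩
  rcases eq_or_ne b 0 with rfl | hb
  · have h1 : m + 1 ≠ 0 := by linarith
    rw [bregman_zero hm, sub_zero, abs_zero, Real.zero_rpow h1, mul_zero, add_zero]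
    calc |a| ^ (m + 1) = (m + 1) * zeta m a := by unfold zeta; field_simp
      _ ≤ max C (m + 1) * zeta m a := by
        have : 0 ≤ zeta m a := by unfold zeta; positivity
        gcongr; exact le_max_right _ _
  · have e : a = b * (a / b) := by field_simp
    have e' : a - b = b * (a / b - 1) := by field_simp
    rw [e', abs_mul, Real.mul_rpow (abs_nonneg _) (abs_nonneg _)]
    nth_rw 2 [e]
    rw [bregman_mul hb]
    have h1 := hC (a / b)
    have h2 : C * bregman m (a / b) 1 ≤ max C (m + 1) * bregman m (a / b) 1 := by
      gcongr
      · exact bregman_nonneg hm _ _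
      · exact le_max_left _ _
    have h3 : 0 ≤ |b| ^ (m + 1) := by positivity
    nlinarith [mul_le_mul_of_nonneg_left (h1.trans (add_le_add_left h2 ε)) h3]

/-! ### Strong convergence in `L^{m+1}` -/

section Strong

variable {α : Type*} [MeasurableSpace α] {μ : Measure α} {m : ℝ}

theorem expo_toReal (hm : 0 < m) : (expo m).toReal = m + 1 := by
  rw [expo, ENNReal.toReal_add (by simp) (by simp), ENNReal.toReal_ofReal hm.le]; simp

theorem expo_ne_top : expo m ≠ ⊤ := by simp [expo]

theorem expo_ne_zero : expo m ≠ 0 := by simp [expo]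

theorem integrable_abs_rpow (hm : 0 < m) (v : Lp ℝ (expo m) μ) :
    Integrable (fun x => |v x| ^ (m + 1)) μ := by
  have := (Lp.memLp v).integrable_norm_rpow expo_ne_zero expo_ne_top
  rw [expo_toReal hm] at this
  exact this

theorem integrable_zeta (hm : 0 < m) (v : Lp ℝ (expo m) μ) :
    Integrable (fun x => zeta m (v x)) μ :=
  (integrable_abs_rpow hm v).div_const _

theorem integrable_beta_mul (hm : 0 < m) (v w : Lp ℝ (expo m) μ) :
    Integrable (fun x => beta m (v x) * w x) μ := by
  refine ((integrable_abs_rpow hm w).add (integrable_abs_rpow hm v)).mono'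
    (((continuous_beta hm).comp_aestronglyMeasurable (Lp.aestronglyMeasurable v)).mul
      (Lp.aestronglyMeasurable w)) (Eventually.of_forall fun x => ?_)
  exact abs_beta_mul_le hm _ _

theorem integrable_bregman (hm : 0 < m) (v w : Lp ℝ (expo m) μ) :
    Integrable (fun x => bregman m (v x) (w x)) μ := by
  unfold bregman
  simp only [mul_sub]
  exact ((integrable_zeta hm v).sub (integrable_zeta hm w)).sub
    ((integrable_beta_mul hm w v).sub (integrable_beta_mul hm w w))

theorem integral_bregman (hm : 0 < m) (v w : Lp ℝ (expo m) μ) :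
    ∫ x, bregman m (v x) (w x) ∂μ = (∫ x, zeta m (v x) ∂μ) - (∫ x, zeta m (w x) ∂μ)
      - ((∫ x, beta m (w x) * v x ∂μ) - ∫ x, beta m (w x) * w x ∂μ) := by
  unfold bregman
  simp only [mul_sub]
  refine (integral_sub ((integrable_zeta hm v).sub (integrable_zeta hm w))
    ((integrable_beta_mul hm w v).sub (integrable_beta_mul hm w w))).trans ?_
  congr 1
  · exact integral_sub (integrable_zeta hm v) (integrable_zeta hm w)
  · exact integral_sub (integrable_beta_mul hm w v) (integrable_beta_mul hm w w)

theorem integral_abs_rpow (hm : 0 < m) (v : Lp ℝ (expo m) μ) :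
    ‖v‖ = (∫ x, |v x| ^ (m + 1) ∂μ) ^ (m + 1)⁻¹ := by
  rw [Lp.norm_def, (Lp.memLp v).eLpNorm_eq_integral_rpow_norm expo_ne_zero expo_ne_top,
    expo_toReal hm, ENNReal.toReal_ofReal]
  · rfl
  · exact Real.rpow_nonneg (integral_nonneg fun x => by positivity) _

/-- The Radon–Riesz property of `L^{m+1}`. -/
theorem tendsto_of_tendsto_integral_zeta (hm : 0 < m) {ι : Type*} {l : Filter ι}
    {v : ι → Lp ℝ (expo m) μ} {w : Lp ℝ (expo m) μ}
    (h1 : Tendsto (fun i => ∫ x, zeta m (v i x) ∂μ) l (𝓝 (∫ x, zeta m (w x) ∂μ)))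
    (h2 : Tendsto (fun i => ∫ x, beta m (w x) * v i x ∂μ) l (𝓝 (∫ x, beta m (w x) * w x ∂μ))) :
    Tendsto v l (𝓝 w) := by
  have hB : Tendsto (fun i => ∫ x, bregman m (v i x) (w x) ∂μ) l (𝓝 0) := by
    simp only [integral_bregman hm]
    have := (h1.sub_const (∫ x, zeta m (w x) ∂μ)).sub
      (h2.sub_const (∫ x, beta m (w x) * w x ∂μ))
    simpa using this
  have hI : Tendsto (fun i => ∫ x, |(v i - w) x| ^ (m + 1) ∂μ) l (𝓝 0) := by
    have K0 : 0 ≤ ∫ x, |w x| ^ (m + 1) ∂μ := integral_nonneg fun x => by positivity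
    set K := ∫ x, |w x| ^ (m + 1) ∂μ
    rw [Metric.tendsto_nhds]
    intro ε hε
    -- The error term integrates to at most `ε / 2`; the `+ 1` avoids division by zero when `w = 0`.
    obtain ⟨C, hC0, hC⟩ := exists_abs_sub_rpow_le hm (ε := ε / (2 * (K + 1))) (by positivity)
    have : ∀ᶠ i in l, C * ∫ x, bregman m (v i x) (w x) ∂μ < ε / 2 := by
      have h3 := hB.const_mul C
      rw [mul_zero] at h3
      exact h3.eventually_lt_const (by positivity)
    filter_upwards [this] with i hi
    have h4 : ∫ x, |(v i - w) x| ^ (m + 1) ∂μ ≤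
        C * (∫ x, bregman m (v i x) (w x) ∂μ) + ε / (2 * (K + 1)) * K := by
      rw [← integral_const_mul, ← integral_const_mul, ← integral_add
        ((integrable_bregman hm _ _).const_mul _) ((integrable_abs_rpow hm w).const_mul _)]
      refine integral_mono_ae (integrable_abs_rpow hm _)
        (((integrable_bregman hm _ _).const_mul _).add ((integrable_abs_rpow hm w).const_mul _)) ?_
      filter_upwards [Lp.coeFn_sub (v i) w] with x hx
      rw [hx]
      exact hC _ _
    have h5 : ε / (2 * (K + 1)) * K ≤ ε / 2 := by
      rw [div_mul_eq_mul_div, div_le_div_iff₀ (by positivity) (by positivity)]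
      nlinarith
    rw [Real.dist_eq, sub_zero, abs_of_nonneg (integral_nonneg fun x => by positivity)]
    linarith
  rw [tendsto_iff_norm_sub_tendsto_zero]
  simp only [integral_abs_rpow hm]
  have := hI.rpow_const (p := (m + 1)⁻¹) (Or.inr (by positivity))
  rwa [Real.zero_rpow (by positivity)] at this

end Strong

/-! ### Superposition functionals on `L²` -/

/-- Convergence in `L²` gives a.e. convergence along a subsequence, so dominated convergence
applies; the subsequence criterion then recovers the full limit. -/
theorem continuous_integral_superposition {α : Type*} [MeasurableSpace α] {μ : Measure α}
    {F : α → ℝ → ℝ} {G : α → ℝ} (hG : Integrable G μ) (hF : ∀ᵐ x ∂μ, Continuous (F x))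
    (hFG : ∀ᵐ x ∂μ, ∀ s, |F x s| ≤ G x)
    (hm : ∀ v : Lp ℝ 2 μ, AEStronglyMeasurable (fun x => F x (v x)) μ) :
    Continuous fun v : Lp ℝ 2 μ => ∫ x, F x (v x) ∂μ := by
  refine continuous_iff_continuousAt.2 fun v => ?_
  refine tendsto_of_subseq_tendsto fun u hu => ?_
  obtain ⟨k, -, hk⟩ := (tendstoInMeasure_of_tendsto_Lp hu).exists_seq_tendsto_ae
  refine ⟨k, tendsto_integral_of_dominated_convergence G (fun n => hm _) hG (fun n => ?_) ?_⟩
  · filter_upwards [hFG] with x hx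
    exact hx _
  · filter_upwards [hk, hF] with x h1 h2
    exact (h2.tendsto _).comp h1

/-! ### Structure of `H^1_0(Ω)` -/

section H10

variable {d : ℕ} {Ω : Set (Space d)}

instance H10.instCompleteSpace : CompleteSpace (H10 Ω) :=
  inferInstanceAs (CompleteSpace (testGraph Ω).topologicalClosure)

/-- The inclusion `H^1_0(Ω) → L²(Ω) × L²(Ω)^d` as a continuous linear map. -/
def H10.toGraphL : H10 Ω →L[ℝ] GraphSpace Ω :=
  (show (testGraph Ω).topologicalClosure →L[ℝ] GraphSpace Ω from
    (testGraph Ω).topologicalClosure.subtypeL)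

/-- The inclusion `H^1_0(Ω) → L²(Ω)` as a continuous linear map. -/
def H10.fnL : H10 Ω →L[ℝ] Lp ℝ 2 (volume.restrict Ω) :=
  (ContinuousLinearMap.fst ℝ _ _).comp
    ((WithLp.prodContinuousLinearEquiv 2 ℝ _ _).toContinuousLinearMap.comp H10.toGraphL)

/-- The weak gradient `H^1_0(Ω) → L²(Ω)^d` as a continuous linear map. -/
def H10.gradL : H10 Ω →L[ℝ] Lp (Space d) 2 (volume.restrict Ω) :=
  (ContinuousLinearMap.snd ℝ _ _).comp
    ((WithLp.prodContinuousLinearEquiv 2 ℝ _ _).toContinuousLinearMap.comp H10.toGraphL)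

theorem H10.norm_sq (w : H10 Ω) : ‖w‖ ^ 2 = ‖w.fn‖ ^ 2 + ‖w.grad‖ ^ 2 :=
  WithLp.prod_norm_sq_eq_of_L2 w.toGraph

theorem H10.norm_grad_le (w : H10 Ω) : ‖w.grad‖ ≤ ‖w‖ :=
  le_of_sq_le_sq (by rw [w.norm_sq]; nlinarith [sq_nonneg ‖w.fn‖]) (norm_nonneg _)

theorem H10.fn_injective (hΩ : IsOpen Ω) : Function.Injective (H10.fn (Ω := Ω)) := by
  intro v w h
  have h1 : v.grad = w.grad :=
    Lp.ext (v.hasWeakGradient.ae_unique hΩ w.hasWeakGradient (by rw [h]))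
  have h2 : v.toGraph = w.toGraph := by
    refine (WithLp.equiv 2 _).injective ?_
    exact Prod.ext h h1
  exact Subtype.ext h2

theorem H10.ofTest_fn_ae {φ : Space d → ℝ} (h : IsTest Ω φ) :
    (H10.ofTest φ h).fn =ᵐ[volume.restrict Ω] φ := h.memLp.coeFn_toLp

theorem H10.exists_seq_ofTest (w : H10 Ω) : ∃ (φ : ℕ → Space d → ℝ) (hφ : ∀ n, IsTest Ω (φ n)),
    Tendsto (fun n => H10.ofTest (φ n) (hφ n)) atTop (𝓝 w) := by
  obtain ⟨p, hp, hlim⟩ := mem_closure_iff_seq_limit.1 w.2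
  choose φ hφ h1 h2 using hp
  refine ⟨φ, hφ, ?_⟩
  refine tendsto_subtype_rng.2 (hlim.congr fun n => ?_)
  refine (WithLp.equiv 2 _).injective (Prod.ext (Lp.ext ?_) (Lp.ext ?_))
  · exact (h1 n).trans (hφ n).memLp.coeFn_toLp.symm
  · exact (h2 n).trans (hφ n).memLp_gradient.coeFn_toLp.symm

/-! ### Truncation of test functions -/

/-- A smooth bounded contraction which tends to the identity as `k → ∞`. -/
def trunc (k s : ℝ) : ℝ := k * Real.sin (s / k)

theorem continuous_trunc (k : ℝ) : Continuous (trunc k) := by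
  unfold trunc; fun_prop

theorem contDiff_trunc (k : ℝ) : ContDiff ℝ ∞ (trunc k) := by
  unfold trunc; fun_prop

theorem abs_trunc_le {k : ℝ} (hk : 0 < k) (s : ℝ) : |trunc k s| ≤ k := by
  rw [trunc, abs_mul, abs_of_pos hk]
  exact mul_le_of_le_one_right hk.le (Real.abs_sin_le_one _)

theorem abs_trunc_le_abs {k : ℝ} (hk : 0 < k) (s : ℝ) : |trunc k s| ≤ |s| := by
  rw [trunc, abs_mul, abs_of_pos hk]
  have : |Real.sin (s / k)| ≤ |s / k| := Real.abs_sin_le_abs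
  calc k * |Real.sin (s / k)| ≤ k * |s / k| := by gcongr
    _ = |s| := by rw [abs_div, abs_of_pos hk]; field_simp

theorem hasDerivAt_trunc {k : ℝ} (hk : 0 < k) (s : ℝ) :
    HasDerivAt (trunc k) (Real.cos (s / k)) s := by
  have := (((hasDerivAt_id s).div_const k).sin).const_mul k
  refine this.congr_deriv ?_
  simp only [id]
  field_simp

theorem tendsto_trunc (s : ℝ) : Tendsto (fun n : ℕ => trunc (n + 1) s) atTop (𝓝 s) := by
  -- The limit is the derivative of `r ↦ sin (s r)` at `0`, sampled along `r = 1 / (n + 1)`.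
  have h : HasDerivAt (fun r : ℝ => Real.sin (s * r)) s 0 := by
    have := ((hasDerivAt_id (0 : ℝ)).const_mul s).sin
    simpa using this
  have h1 := h.tendsto_slope_zero
  have h2 : Tendsto (fun n : ℕ => ((n : ℝ) + 1)⁻¹) atTop (𝓝[≠] 0) := by
    refine tendsto_nhdsWithin_iff.2 ⟨?_, Eventually.of_forall fun n => ?_⟩
    · simpa using tendsto_one_div_add_atTop_nhds_zero_nat (𝕜 := ℝ)
    · simp only [mem_compl_iff, mem_singleton_iff]; positivity
  refine (h1.comp h2).congr fun n => ?_
  simp [trunc, div_eq_mul_inv]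

theorem IsTest.trunc {φ : Space d → ℝ} (h : IsTest Ω φ) (k : ℝ) :
    IsTest Ω (fun x => trunc k (φ x)) := by
  have h0 : PorousMedium.trunc k 0 = 0 := by simp [PorousMedium.trunc]
  have hc : HasCompactSupport (PorousMedium.trunc k ∘ φ) := h.compact.comp_left h0
  refine ⟨(contDiff_trunc k).comp h.smooth, hc, ?_⟩
  refine (closure_mono fun x hx => ?_).trans h.subset
  intro h1
  exact hx (by simp only [h1, h0])

theorem gradient_trunc {φ : Space d → ℝ} (h : IsTest Ω φ) {k : ℝ} (hk : 0 < k) (x : Space d) :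
    gradient (fun x => trunc k (φ x)) x = Real.cos (φ x / k) • gradient φ x := by
  have h1 : HasFDerivAt φ (fderiv ℝ φ x) x :=
    (h.smooth.differentiable (by simp) x).hasFDerivAt
  have h2 := (hasDerivAt_trunc hk (φ x)).comp_hasFDerivAt x h1
  simp only [gradient]
  rw [show fderiv ℝ (fun x => trunc k (φ x)) x = _ from h2.fderiv, map_smul]

/-- Truncation by a sine multiplies the gradient by a cosine and decreases absolute values.
Smoothness keeps the result a test function, so no chain rule in `H^1_0` is needed. -/
theorem norm_ofTest_trunc_le {φ : Space d → ℝ} (h : IsTest Ω φ) {k : ℝ} (hk : 0 < k) :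
    ‖H10.ofTest _ (h.trunc k)‖ ≤ ‖H10.ofTest φ h‖ := by
  refine le_of_sq_le_sq ?_ (norm_nonneg _)
  rw [H10.norm_sq, H10.norm_sq]
  have h1 : ‖(H10.ofTest _ (h.trunc k)).fn‖ ≤ ‖(H10.ofTest φ h).fn‖ := by
    refine Lp.norm_le_norm_of_ae_le ?_
    filter_upwards [(h.trunc k).memLp.coeFn_toLp, h.memLp.coeFn_toLp] with x e1 e2
    change ‖((h.trunc k).memLp.toLp _) x‖ ≤ ‖(h.memLp.toLp _) x‖
    rw [e1, e2]
    exact abs_trunc_le_abs hk _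
  have h2 : ‖(H10.ofTest _ (h.trunc k)).grad‖ ≤ ‖(H10.ofTest φ h).grad‖ := by
    refine Lp.norm_le_norm_of_ae_le ?_
    filter_upwards [(h.trunc k).memLp_gradient.coeFn_toLp,
      h.memLp_gradient.coeFn_toLp] with x e1 e2
    change ‖((h.trunc k).memLp_gradient.toLp _) x‖ ≤ ‖(h.memLp_gradient.toLp _) x‖
    rw [e1, e2, gradient_trunc h hk, norm_smul]
    exact mul_le_of_le_one_left (norm_nonneg _) (Real.abs_cos_le_one _)
  gcongr

/-! ### Distributions which are both functions and elements of `H^{-1}(Ω)` -/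

/-- Density of `L²` in `H^{-1}`: the inclusion `H^1_0 → L²` is injective because weak gradients are
unique, hence its adjoint has dense range. -/
theorem exists_norm_sub_inner_fn_le (hΩ : IsOpen Ω) (L : StrongDual ℝ (H10 Ω)) {ε : ℝ}
    (hε : 0 < ε) : ∃ a : Lp ℝ 2 (volume.restrict Ω),
      ‖L - (innerSL ℝ a).comp H10.fnL‖ ≤ ε := by
  have hd : DenseRange (ContinuousLinearMap.adjoint (H10.fnL (Ω := Ω))) := by
    have h1 : (ContinuousLinearMap.adjoint (H10.fnL (Ω := Ω))).rangeᗮ = ⊥ := by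
      rw [ContinuousLinearMap.orthogonal_range, ContinuousLinearMap.adjoint_adjoint,
        LinearMap.ker_eq_bot]
      exact H10.fn_injective hΩ
    rw [← Submodule.topologicalClosure_eq_top_iff,
      ← Submodule.dense_iff_topologicalClosure_eq_top] at h1
    exact h1
  obtain ⟨a, ha⟩ := Metric.denseRange_iff.1 hd ((InnerProductSpace.toDual ℝ _).symm L) ε hε
  refine ⟨a, ?_⟩
  have e : L - (innerSL ℝ a).comp H10.fnL = InnerProductSpace.toDual ℝ (H10 Ω)
      ((InnerProductSpace.toDual ℝ _).symm L - ContinuousLinearMap.adjoint H10.fnL a) := by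
    ext w
    simp [ContinuousLinearMap.adjoint_inner_left]
  rw [e, LinearIsometryEquiv.norm_map, ← dist_eq_norm]
  exact ha.le

/-- For `h` merely integrable, `w ↦ ∫ h w` need not be continuous on `L²`, but its truncated version
is. The bound therefore passes to the limit from test functions, where `D` evaluated at the
truncation is bounded by its norm. -/
theorem abs_integral_mul_trunc_le {h : Space d → ℝ} (hh : IntegrableOn h Ω)
    {D : StrongDual ℝ (H10 Ω)} {ε : ℝ} (hD : ‖D‖ ≤ ε)
    (hDh : ∀ (ψ : Space d → ℝ) (hψ : IsTest Ω ψ), D (H10.ofTest ψ hψ) = ∫ x in Ω, h x * ψ x)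
    (w : H10 Ω) {k : ℝ} (hk : 0 < k) :
    |∫ x in Ω, h x * trunc k (w.fn x)| ≤ ε * ‖w‖ := by
  obtain ⟨φ, hφ, lim⟩ := w.exists_seq_ofTest
  have cont := continuous_integral_superposition (μ := volume.restrict Ω)
    (F := fun x s => h x * trunc k s) (G := fun x => |h x| * k) (hh.abs.mul_const k)
    (Eventually.of_forall fun x => (continuous_trunc k).const_mul _)
    (Eventually.of_forall fun x s => by
      rw [abs_mul]; gcongr; exact abs_trunc_le hk s)
    (fun v => hh.aestronglyMeasurable.mul
      ((continuous_trunc k).comp_aestronglyMeasurable (Lp.aestronglyMeasurable v)))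
  have lim' := ((cont.comp H10.fnL.continuous).tendsto w).comp lim
  refine le_of_tendsto_of_tendsto lim'.abs (lim.norm.const_mul ε) (Eventually.of_forall ?_)
  intro n
  have e : (∫ x in Ω, h x * trunc k ((H10.ofTest (φ n) (hφ n)).fn x)) =
      D (H10.ofTest _ ((hφ n).trunc k)) := by
    rw [hDh]
    refine integral_congr_ae ?_
    filter_upwards [H10.ofTest_fn_ae (hφ n)] with x e1
    rw [e1]
  change |∫ x in Ω, h x * trunc k ((H10.ofTest (φ n) (hφ n)).fn x)| ≤ _
  rw [e, ← Real.norm_eq_abs]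
  refine (D.le_opNorm _).trans ?_
  exact mul_le_mul hD (norm_ofTest_trunc_le (hφ n) hk) (norm_nonneg _) ((norm_nonneg _).trans hD)

theorem abs_integral_mul_fn_le {h : Space d → ℝ} (hh : IntegrableOn h Ω)
    {D : StrongDual ℝ (H10 Ω)} {ε : ℝ} (hD : ‖D‖ ≤ ε)
    (hDh : ∀ (ψ : Space d → ℝ) (hψ : IsTest Ω ψ), D (H10.ofTest ψ hψ) = ∫ x in Ω, h x * ψ x)
    (w : H10 Ω) (hw : IntegrableOn (fun x => h x * w.fn x) Ω) :
    |∫ x in Ω, h x * w.fn x| ≤ ε * ‖w‖ := by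
  have lim2 : Tendsto (fun n : ℕ => ∫ x in Ω, h x * trunc (n + 1) (w.fn x)) atTop
      (𝓝 (∫ x in Ω, h x * w.fn x)) := by
    refine tendsto_integral_of_dominated_convergence (fun x => |h x * w.fn x|) (fun n => ?_)
      hw.abs (fun n => Eventually.of_forall fun x => ?_)
      (Eventually.of_forall fun x => (tendsto_trunc _).const_mul _)
    · exact hh.aestronglyMeasurable.mul
        ((continuous_trunc _).comp_aestronglyMeasurable (Lp.aestronglyMeasurable _))
    · rw [Real.norm_eq_abs, abs_mul, abs_mul]
      exact mul_le_mul_of_nonneg_left (abs_trunc_le_abs n.cast_add_one_pos _) (abs_nonneg _)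
  exact le_of_tendsto lim2.abs (Eventually.of_forall fun n =>
    abs_integral_mul_trunc_le hh hD hDh w n.cast_add_one_pos)

theorem IsTest.integrable_mul {ψ : Space d → ℝ} (hψ : IsTest Ω ψ) {h : Space d → ℝ}
    (hh : IntegrableOn h Ω) : IntegrableOn (fun x => h x * ψ x) Ω := by
  obtain ⟨C, hC⟩ := hψ.smooth.continuous.bounded_above_of_compact_support hψ.compact
  exact Integrable.mul_bdd hh hψ.smooth.continuous.aestronglyMeasurable (Eventually.of_forall hC)

/-- Subtract from `L` an `L²` function `a` that is `ε`-close in `H^{-1}`. The identity is exact for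
`a`; for the remainder, the functional and the integral are each at most `ε‖w‖`, the latter by
truncation. Integrability of `h w` is what permits removing the truncation. -/
theorem dual_apply_eq_integral (hΩ : IsOpen Ω) [IsFiniteMeasure (volume.restrict Ω)]
    {h : Space d → ℝ} (hh : IntegrableOn h Ω) (L : StrongDual ℝ (H10 Ω))
    (hL : ∀ (ψ : Space d → ℝ) (hψ : IsTest Ω ψ), L (H10.ofTest ψ hψ) = ∫ x in Ω, h x * ψ x)
    (w : H10 Ω) (hw : IntegrableOn (fun x => h x * w.fn x) Ω) :
    L w = ∫ x in Ω, h x * w.fn x := by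
  suffices H : ∀ ε > 0, |L w - ∫ x in Ω, h x * w.fn x| ≤ ε * (2 * ‖w‖) by
    have h1 : |L w - ∫ x in Ω, h x * w.fn x| ≤ 0 := by
      have : Tendsto (fun ε : ℝ => ε * (2 * ‖w‖)) (𝓝[>] 0) (𝓝 0) := by
        have : Tendsto (fun ε : ℝ => ε * (2 * ‖w‖)) (𝓝 0) (𝓝 (0 * (2 * ‖w‖))) :=
          tendsto_id.mul_const _
        rw [zero_mul] at this
        exact this.mono_left nhdsWithin_le_nhds
      exact ge_of_tendsto this (eventually_mem_nhdsWithin.mono fun ε hε => H ε hε)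
    exact sub_eq_zero.1 (abs_nonpos_iff.1 h1)
  intro ε hε
  obtain ⟨a, ha⟩ := exists_norm_sub_inner_fn_le hΩ L hε
  have ia : ∀ v : Lp ℝ 2 (volume.restrict Ω), IntegrableOn (fun x => a x * v x) Ω := fun v =>
    memLp_one_iff_integrable.1 ((Lp.memLp v).mul (Lp.memLp a))
  have inner_a : ∀ v : Lp ℝ 2 (volume.restrict Ω), inner ℝ a v = ∫ x in Ω, a x * v x := by
    intro v
    rw [L2.inner_def]
    simp [mul_comm]
  have a1 : IntegrableOn a Ω := (Lp.memLp a).integrable (by norm_num)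
  have b1 : |∫ x in Ω, (h x - a x) * w.fn x| ≤ ε * ‖w‖ := by
    refine abs_integral_mul_fn_le (h := fun x => h x - a x) (hh.sub a1) ha (fun ψ hψ => ?_) w ?_
    · have e1 : (L - (innerSL ℝ a).comp H10.fnL) (H10.ofTest ψ hψ) =
          L (H10.ofTest ψ hψ) - inner ℝ a (H10.ofTest ψ hψ).fn := rfl
      rw [e1, hL, inner_a, ← integral_sub (hψ.integrable_mul hh) (ia _)]
      refine integral_congr_ae ?_
      filter_upwards [H10.ofTest_fn_ae hψ] with x hx
      rw [hx, ← sub_mul]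
    · exact (hw.sub (ia w.fn)).congr (Eventually.of_forall fun x => (sub_mul _ _ _).symm)
  have b2 : |(L - (innerSL ℝ a).comp H10.fnL) w| ≤ ε * ‖w‖ := by
    refine ((L - (innerSL ℝ a).comp H10.fnL).le_opNorm w).trans ?_
    gcongr
  have e1 : ∫ x in Ω, (h x - a x) * w.fn x = (∫ x in Ω, h x * w.fn x) - inner ℝ a w.fn := by
    simp only [sub_mul]
    rw [inner_a, integral_sub hw (ia _)]
  have e2 : (L - (innerSL ℝ a).comp H10.fnL) w = L w - inner ℝ a w.fn := rfl
  rw [e1] at b1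
  rw [e2] at b2
  calc |L w - ∫ x in Ω, h x * w.fn x|
      = |(L w - inner ℝ a w.fn) - ((∫ x in Ω, h x * w.fn x) - inner ℝ a w.fn)| := by
        congr 1; ring
    _ ≤ ε * ‖w‖ + ε * ‖w‖ := (abs_sub _ _).trans (add_le_add b2 b1)
    _ = ε * (2 * ‖w‖) := by ring

end H10

/-! ### Measurability of superpositions -/

/-- Approximating `w` by simple functions reduces the claim to finite sums of restrictions of `F ·
c`; continuity in the second variable gives the limit. -/
theorem aestronglyMeasurable_superposition {α ι β : Type*} [MeasurableSpace α] {μ : Measure α}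
    [TopologicalSpace ι] [NormedAddCommGroup β] {F : α → ι → β}
    (hF : ∀ i, AEStronglyMeasurable (fun x => F x i) μ) (hc : ∀ᵐ x ∂μ, Continuous (F x))
    {w : α → ι} (hw : AEStronglyMeasurable w μ) :
    AEStronglyMeasurable (fun x => F x (w x)) μ := by
  obtain ⟨w', hw', e⟩ := hw
  have h1 : AEStronglyMeasurable (fun x => F x (w' x)) μ := by
    refine aestronglyMeasurable_of_tendsto_ae atTop (f := fun n x => F x (hw'.approx n x))
      (fun n => ?_) ?_
    · have e2 : (fun x => F x (hw'.approx n x)) = fun x => ∑ c ∈ (hw'.approx n).range,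
          (hw'.approx n ⁻¹' {c}).indicator (fun x => F x c) x := by
        funext x
        rw [Finset.sum_eq_single (hw'.approx n x)]
        · rw [indicator_of_mem]; rfl
        · intro c _ hc
          exact indicator_of_notMem (fun h => hc h.symm) _
        · intro h
          exact absurd (SimpleFunc.mem_range_self _ _) h
      rw [e2]
      exact Finset.aestronglyMeasurable_fun_sum _ fun c _ =>
        (hF c).indicator (SimpleFunc.measurableSet_fiber _ _)
    · filter_upwards [hc] with x hx
      exact (hx.tendsto _).comp (hw'.tendsto_approx x)
  refine h1.congr ?_
  filter_upwards [e] with x hx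
  rw [hx]

/-! ### The diffusion tensor -/

section Tensor

variable {d : ℕ} {Ω : Set (Space d)} {Λ : Space d → ℝ → (Space d →L[ℝ] Space d)}

/-- Evaluating the form at `ξ + s A ξ` produces the cross term `2 s ‖A ξ‖²`, by symmetry, and the
form bound controls it. The constant is not optimal. -/
theorem norm_le_of_isSymmetric_of_inner_le {H : Type*} [NormedAddCommGroup H]
    [InnerProductSpace ℝ H] {A : H →L[ℝ] H} (hA : (A : H →ₗ[ℝ] H).IsSymmetric) {M : ℝ}
    (hM : 0 < M) (h0 : ∀ ξ, 0 ≤ inner ℝ (A ξ) ξ) (h1 : ∀ ξ, inner ℝ (A ξ) ξ ≤ M * ‖ξ‖ ^ 2) :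
    ‖A‖ ≤ 2 * M := by
  refine A.opNorm_le_bound (by positivity) fun ξ => ?_
  set η := A ξ with hη
  -- With `M s = 1/2`, half of the cross term absorbs the `‖η‖²` contribution from the right side.
  set s : ℝ := (2 * M)⁻¹ with hs
  have hs0 : 0 < s := by positivity
  have e1 : inner ℝ (A (ξ + s • η)) (ξ + s • η)
      = inner ℝ (A ξ) ξ + 2 * s * ‖η‖ ^ 2 + s ^ 2 * inner ℝ (A η) η := by
    have sy : inner ℝ (A η) ξ = ‖η‖ ^ 2 := by
      have : inner ℝ (A η) ξ = inner ℝ η (A ξ) := hA η ξ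
      rw [this, ← hη, real_inner_self_eq_norm_sq]
    simp only [map_add, map_smul, inner_add_left, inner_add_right, inner_smul_left,
      inner_smul_right, sy, ← hη, real_inner_self_eq_norm_sq]
    simp
    ring
  have b1 := h1 (ξ + s • η)
  have b2 : ‖ξ + s • η‖ ^ 2 ≤ 2 * (‖ξ‖ ^ 2 + s ^ 2 * ‖η‖ ^ 2) := by
    have h3 : ‖ξ + s • η‖ ≤ ‖ξ‖ + s * ‖η‖ := by
      refine (norm_add_le _ _).trans_eq ?_
      rw [norm_smul, Real.norm_of_nonneg hs0.le]
    nlinarith [sq_nonneg (‖ξ‖ - s * ‖η‖), norm_nonneg (ξ + s • η),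
      mul_nonneg hs0.le (norm_nonneg η), norm_nonneg ξ]
  have b3 : 0 ≤ s ^ 2 * inner ℝ (A η) η := mul_nonneg (sq_nonneg _) (h0 η)
  have b4 := h0 ξ
  have b5 : 2 * s * ‖η‖ ^ 2 ≤ M * (2 * (‖ξ‖ ^ 2 + s ^ 2 * ‖η‖ ^ 2)) := by
    have := mul_le_mul_of_nonneg_left b2 hM.le
    linarith
  have hMs : M * s = 1 / 2 := by rw [hs]; field_simp
  have b6 : s * ‖η‖ ^ 2 ≤ 2 * M * ‖ξ‖ ^ 2 := by
    have : M * (2 * (‖ξ‖ ^ 2 + s ^ 2 * ‖η‖ ^ 2)) = 2 * M * ‖ξ‖ ^ 2 + 2 * (M * s) * s * ‖η‖ ^ 2 := by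
      ring
    rw [this, hMs] at b5
    linarith
  have b7 : ‖η‖ ^ 2 ≤ (2 * M * ‖ξ‖) ^ 2 := by
    have : ‖η‖ ^ 2 = 2 * (M * s) * ‖η‖ ^ 2 := by rw [hMs]; ring
    rw [this]
    nlinarith
  exact le_of_sq_le_sq b7 (by positivity)

/-- The exceptional null set in the ellipticity condition depends on `(s, ξ)`. A countable dense set
of pairs gives one null set, and continuity extends the bounds to all pairs. -/
theorem IsDiffusionTensor.exists_bound (hΛ : IsDiffusionTensor Ω Λ) (hΩ : MeasurableSet Ω) :
    ∃ M : ℝ, ∀ᵐ x ∂(volume.restrict Ω), ∀ s, ‖Λ x s‖ ≤ M := by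
  obtain ⟨lam, M, hlam, hM, h⟩ := hΛ.elliptic
  refine ⟨2 * M, ?_⟩
  have h1 : ∀ᵐ x ∂(volume.restrict Ω), ∀ n : ℕ,
      0 ≤ inner ℝ (Λ x (TopologicalSpace.denseSeq (ℝ × Space d) n).1
        (TopologicalSpace.denseSeq (ℝ × Space d) n).2)
        (TopologicalSpace.denseSeq (ℝ × Space d) n).2 ∧
      inner ℝ (Λ x (TopologicalSpace.denseSeq (ℝ × Space d) n).1
        (TopologicalSpace.denseSeq (ℝ × Space d) n).2)
        (TopologicalSpace.denseSeq (ℝ × Space d) n).2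
        ≤ M * ‖(TopologicalSpace.denseSeq (ℝ × Space d) n).2‖ ^ 2 := by
    refine ae_all_iff.2 fun n => ?_
    filter_upwards [h (TopologicalSpace.denseSeq (ℝ × Space d) n).1
      (TopologicalSpace.denseSeq (ℝ × Space d) n).2] with x hx
    exact ⟨le_trans (by positivity) hx.1, hx.2⟩
  filter_upwards [h1, ae_restrict_mem hΩ] with x hx hxΩ
  have c1 : Continuous fun p : ℝ × Space d => inner ℝ (Λ x p.1 p.2) p.2 :=
    (((hΛ.cont x hxΩ).comp continuous_fst).clm_apply continuous_snd).inner continuous_snd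
  have cl : IsClosed {p : ℝ × Space d | 0 ≤ inner ℝ (Λ x p.1 p.2) p.2 ∧
      inner ℝ (Λ x p.1 p.2) p.2 ≤ M * ‖p.2‖ ^ 2} :=
    (isClosed_le continuous_const c1).inter (isClosed_le c1 (by fun_prop))
  have all : ∀ p : ℝ × Space d, 0 ≤ inner ℝ (Λ x p.1 p.2) p.2 ∧
      inner ℝ (Λ x p.1 p.2) p.2 ≤ M * ‖p.2‖ ^ 2 := fun p =>
    (TopologicalSpace.denseRange_denseSeq (ℝ × Space d)).induction_on p cl hx
  exact fun s => norm_le_of_isSymmetric_of_inner_le (hΛ.symm x hxΩ s) hM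
    (fun ξ => (all (s, ξ)).1) (fun ξ => (all (s, ξ)).2)

theorem IsDiffusionTensor.aestronglyMeasurable_comp (hΛ : IsDiffusionTensor Ω Λ)
    (hΩ : MeasurableSet Ω) {w : Space d → ℝ} (hw : AEStronglyMeasurable w (volume.restrict Ω)) :
    AEStronglyMeasurable (fun x => Λ x (w x)) (volume.restrict Ω) :=
  aestronglyMeasurable_superposition hΛ.meas
    ((ae_restrict_mem hΩ).mono fun x hx => hΛ.cont x hx) hw

/-- The quadratic form `∫_Ω Λ(x, β⁻¹(v)) p · p` as a function of `v` and `p`. -/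
def quadForm (Ω : Set (Space d)) (m : ℝ) (Λ : Space d → ℝ → (Space d →L[ℝ] Space d))
    (v : Space d → ℝ) (p : Space d → Space d) : ℝ :=
  ∫ x in Ω, inner ℝ (Λ x (beta m⁻¹ (v x)) (p x)) (p x)

theorem IsDiffusionTensor.integrable_inner (hΛ : IsDiffusionTensor Ω Λ)
    (hΩ : MeasurableSet Ω) {w : Space d → ℝ} (hw : AEStronglyMeasurable w (volume.restrict Ω))
    {M : ℝ} (hM : ∀ᵐ x ∂(volume.restrict Ω), ∀ s, ‖Λ x s‖ ≤ M)
    (p : Lp (Space d) 2 (volume.restrict Ω)) :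
    IntegrableOn (fun x => inner ℝ (Λ x (w x) (p x)) (p x)) Ω ∧
      |∫ x in Ω, inner ℝ (Λ x (w x) (p x)) (p x)| ≤ M * ‖p‖ ^ 2 := by
  have i2 : Integrable (fun x => ‖p x‖ ^ 2) (volume.restrict Ω) :=
    (memLp_two_iff_integrable_sq_norm (Lp.aestronglyMeasurable p)).1 (Lp.memLp p)
  have bd : ∀ᵐ x ∂(volume.restrict Ω), ‖inner ℝ (Λ x (w x) (p x)) (p x)‖ ≤ M * ‖p x‖ ^ 2 := by
    filter_upwards [hM] with x hx
    calc ‖inner ℝ (Λ x (w x) (p x)) (p x)‖ ≤ ‖Λ x (w x) (p x)‖ * ‖p x‖ := norm_inner_le_norm _ _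
      _ ≤ (M * ‖p x‖) * ‖p x‖ := by
        gcongr
        exact (Λ x (w x)).le_of_opNorm_le (hx _) _
      _ = M * ‖p x‖ ^ 2 := by ring
  have e : ∫ x in Ω, ‖p x‖ ^ 2 = ‖p‖ ^ 2 := by
    rw [← real_inner_self_eq_norm_sq, L2.inner_def]
    simp only [real_inner_self_eq_norm_sq]
  refine ⟨(i2.const_mul M).mono' ?_ bd, ?_⟩
  · exact ((ContinuousLinearMap.id ℝ (Space d →L[ℝ] Space d)).aestronglyMeasurable_comp₂
      (hΛ.aestronglyMeasurable_comp hΩ hw) (Lp.aestronglyMeasurable p)).inner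
      (Lp.aestronglyMeasurable p)
  · rw [← e, ← integral_const_mul]
    exact norm_integral_le_of_norm_le (i2.const_mul M) bd

theorem IsDiffusionTensor.continuous_quadForm_left (hΛ : IsDiffusionTensor Ω Λ)
    (hΩ : MeasurableSet Ω) {m : ℝ} (hm : 0 < m) (p : Lp (Space d) 2 (volume.restrict Ω)) :
    Continuous fun v : Lp ℝ 2 (volume.restrict Ω) => quadForm Ω m Λ v p := by
  obtain ⟨M, hM⟩ := hΛ.exists_bound hΩ
  have i2 : Integrable (fun x => ‖p x‖ ^ 2) (volume.restrict Ω) :=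
    (memLp_two_iff_integrable_sq_norm (Lp.aestronglyMeasurable p)).1 (Lp.memLp p)
  have cb := continuous_beta (inv_pos.2 hm)
  refine continuous_integral_superposition (μ := volume.restrict Ω)
    (F := fun x s => inner ℝ (Λ x (beta m⁻¹ s) (p x)) (p x)) (i2.const_mul M) ?_ ?_ ?_
  · filter_upwards [ae_restrict_mem hΩ] with x hx
    exact (((hΛ.cont x hx).comp cb).clm_apply continuous_const).inner continuous_const
  · filter_upwards [hM] with x hx s
    calc |inner ℝ (Λ x (beta m⁻¹ s) (p x)) (p x)|
        ≤ ‖Λ x (beta m⁻¹ s) (p x)‖ * ‖p x‖ := abs_real_inner_le_norm _ _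
      _ ≤ (M * ‖p x‖) * ‖p x‖ := by
        gcongr
        exact (Λ x _).le_of_opNorm_le (hx _) _
      _ = M * ‖p x‖ ^ 2 := by ring
  · intro v
    have := cb.comp_aestronglyMeasurable (Lp.aestronglyMeasurable v)
    exact (hΛ.integrable_inner hΩ this hM p).1.aestronglyMeasurable

theorem IsDiffusionTensor.continuous_quadForm_right (hΛ : IsDiffusionTensor Ω Λ)
    (hΩ : MeasurableSet Ω) {m : ℝ} (hm : 0 < m) (v : Lp ℝ 2 (volume.restrict Ω)) :
    Continuous fun p : Lp (Space d) 2 (volume.restrict Ω) => quadForm Ω m Λ v p := by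
  obtain ⟨M, hM⟩ := hΛ.exists_bound hΩ
  have mA : MemLp (fun x => Λ x (beta m⁻¹ (v x))) ∞ (volume.restrict Ω) :=
    memLp_top_of_bound (hΛ.aestronglyMeasurable_comp hΩ
      ((continuous_beta (inv_pos.2 hm)).comp_aestronglyMeasurable (Lp.aestronglyMeasurable v))) M
      (hM.mono fun x hx => hx _)
  -- For fixed `v` the tensor is a bounded matrix field, hence a bounded operator `S` on `L²`, and
  -- the form is `⟨S p, p⟩`.
  set S := (ContinuousLinearMap.id ℝ (Space d →L[ℝ] Space d)).holderL (volume.restrict Ω) ∞ 2 2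
    (mA.toLp _) with hS
  have c : Continuous fun p : Lp (Space d) 2 (volume.restrict Ω) => inner ℝ (S p) p :=
    S.continuous.inner continuous_id
  refine c.congr fun p => ?_
  rw [L2.inner_def, quadForm]
  refine integral_congr_ae ?_
  filter_upwards [ContinuousLinearMap.coeFn_holder (r := 2)
    (ContinuousLinearMap.id ℝ (Space d →L[ℝ] Space d)) (mA.toLp _) p, mA.coeFn_toLp] with x h1 h2
  have h3 : S p x = Λ x (beta m⁻¹ (v x)) (p x) := by
    rw [hS, ContinuousLinearMap.holderL_apply_apply, h1, h2]; rfl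
  rw [h3]

/-- Separate continuity in `v` and `p` suffices: freeze `p` for measurability in time, then
superpose. Writing `u` as `β⁻¹(b)` makes everything depend on the strongly measurable curve `b`. -/
theorem IsDiffusionTensor.aestronglyMeasurable_quadForm (hΛ : IsDiffusionTensor Ω Λ)
    (hΩ : MeasurableSet Ω) {m : ℝ} (hm : 0 < m) {α : Type*} [MeasurableSpace α] {μ : Measure α}
    {b : α → H10 Ω} (hb : AEStronglyMeasurable b μ) :
    AEStronglyMeasurable (fun t => quadForm Ω m Λ (b t).fn (b t).grad) μ := by
  refine aestronglyMeasurable_superposition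
    (F := fun t (p : Lp (Space d) 2 (volume.restrict Ω)) => quadForm Ω m Λ (b t).fn p)
    (fun p => ?_) (Eventually.of_forall fun t => hΛ.continuous_quadForm_right hΩ hm _)
    (H10.gradL.continuous.comp_aestronglyMeasurable hb)
  exact (hΛ.continuous_quadForm_left hΩ hm p).comp_aestronglyMeasurable
    (H10.fnL.continuous.comp_aestronglyMeasurable hb)

theorem IsDiffusionTensor.integrable_quadForm (hΛ : IsDiffusionTensor Ω Λ)
    (hΩ : MeasurableSet Ω) {m : ℝ} (hm : 0 < m) {α : Type*} [MeasurableSpace α] {μ : Measure α}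
    {b : α → H10 Ω} (hb : MemLp b 2 μ) :
    Integrable (fun t => quadForm Ω m Λ (b t).fn (b t).grad) μ := by
  obtain ⟨M, hM⟩ := hΛ.exists_bound hΩ
  have i2 : Integrable (fun t => ‖b t‖ ^ 2) μ :=
    (memLp_two_iff_integrable_sq_norm hb.aestronglyMeasurable).1 hb
  refine (i2.const_mul |M|).mono' (hΛ.aestronglyMeasurable_quadForm hΩ hm hb.aestronglyMeasurable)
    (Eventually.of_forall fun t => ?_)
  have h1 := (hΛ.integrable_inner hΩ ((continuous_beta (inv_pos.2 hm)).comp_aestronglyMeasurable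
    (Lp.aestronglyMeasurable (b t).fn)) hM (b t).grad).2
  refine h1.trans ?_
  have := (b t).norm_grad_le
  gcongr
  exact le_abs_self M

end Tensor

/-! ### The source term -/

section Source

variable {d : ℕ} {Ω : Set (Space d)} {T : ℝ} {f : ℝ → Space d → ℝ}

theorem memLp_prod_of_memLp_restrict (hf : MemLp (Function.uncurry f) 2
      ((volume : Measure (ℝ × Space d)).restrict (Ioo 0 T ×ˢ Ω))) :
    MemLp (Function.uncurry f) 2
      ((volume.restrict (Ioo 0 T)).prod (volume.restrict Ω)) := by
  rwa [Measure.prod_restrict, ← Measure.volume_eq_prod]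

theorem ae_memLp_slice {μ : Measure ℝ} {ν : Measure (Space d)} [SFinite μ] [SFinite ν]
    (hf : MemLp (Function.uncurry f) 2 (μ.prod ν)) : ∀ᵐ t ∂μ, MemLp (f t) 2 ν := by
  have i2 := (memLp_two_iff_integrable_sq_norm hf.aestronglyMeasurable).1 hf
  filter_upwards [hf.aestronglyMeasurable.prodMk_left, i2.prod_right_ae] with t h1 h2
  exact (memLp_two_iff_integrable_sq_norm h1).2 h2

/-- For a.e. `t` the slice `f t` acts on `L²` by an inner product, so superposition gives
measurability in `t`; the domination is `|ab| ≤ a² + b²`. -/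
theorem integrable_integral_mul {μ : Measure ℝ} {ν : Measure (Space d)} [SFinite μ] [SFinite ν]
    (hf : MemLp (Function.uncurry f) 2 (μ.prod ν)) {v : ℝ → Lp ℝ 2 ν} (hv : MemLp v 2 μ) :
    Integrable (fun t => ∫ x, f t x * v t x ∂ν) μ := by
  have i2 := (memLp_two_iff_integrable_sq_norm hf.aestronglyMeasurable).1 hf
  have j2 : Integrable (fun t => ‖v t‖ ^ 2) μ :=
    (memLp_two_iff_integrable_sq_norm hv.aestronglyMeasurable).1 hv
  refine (i2.integral_prod_left.add j2).mono' ?_ ?_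
  · refine aestronglyMeasurable_superposition
      (F := fun t (w : Lp ℝ 2 ν) => ∫ x, f t x * w x ∂ν) (fun w => ?_) ?_ hv.aestronglyMeasurable
    · refine AEStronglyMeasurable.integral_prod_right'
        (f := fun p : ℝ × Space d => Function.uncurry f p * w p.2) ?_
      exact hf.aestronglyMeasurable.mul (Lp.aestronglyMeasurable w).comp_snd
    · filter_upwards [ae_memLp_slice hf] with t ht
      have c : Continuous fun w : Lp ℝ 2 ν => inner ℝ (ht.toLp (f t)) w :=
        continuous_const.inner continuous_id
      refine c.congr fun w => ?_
      rw [L2.inner_def]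
      refine integral_congr_ae ?_
      filter_upwards [ht.coeFn_toLp] with x hx
      rw [hx]
      simp [mul_comm]
  · filter_upwards [ae_memLp_slice hf] with t ht
    have k1 : Integrable (fun x => ‖f t x‖ ^ 2) ν :=
      (memLp_two_iff_integrable_sq_norm ht.aestronglyMeasurable).1 ht
    have k2 : Integrable (fun x => ‖v t x‖ ^ 2) ν :=
      (memLp_two_iff_integrable_sq_norm (Lp.aestronglyMeasurable (v t))).1 (Lp.memLp (v t))
    have e : ∫ x, ‖v t x‖ ^ 2 ∂ν = ‖v t‖ ^ 2 := by
      rw [← real_inner_self_eq_norm_sq, L2.inner_def]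
      simp only [real_inner_self_eq_norm_sq]
    have : ‖∫ x, f t x * v t x ∂ν‖ ≤ ∫ x, (‖f t x‖ ^ 2 + ‖v t x‖ ^ 2) ∂ν := by
      refine norm_integral_le_of_norm_le (k1.add k2) (Eventually.of_forall fun x => ?_)
      rw [norm_mul]
      nlinarith [sq_nonneg (‖f t x‖ - ‖v t x‖), norm_nonneg (f t x), norm_nonneg (v t x)]
    rw [integral_add k1 k2, e] at this
    exact this

end Source

/-! ### The fundamental theorem of calculus for distributional derivatives -/

theorem contDiff_smoothTransition : ContDiff ℝ ∞ Real.smoothTransition :=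
  Real.smoothTransition.contDiff

theorem deriv_smoothTransition_eq_zero {r : ℝ} (hr : r ∉ Icc 0 1) :
    deriv Real.smoothTransition r = 0 := by
  rw [mem_Icc, not_and_or, not_le, not_le] at hr
  rcases hr with h | h
  · have : Real.smoothTransition =ᶠ[𝓝 r] fun _ => 0 := by
      filter_upwards [eventually_lt_nhds h] with x hx
      exact Real.smoothTransition.zero_of_nonpos hx.le
    rw [this.deriv_eq, deriv_const]
  · have : Real.smoothTransition =ᶠ[𝓝 r] fun _ => 1 := by
      filter_upwards [eventually_gt_nhds h] with x hx
      exact Real.smoothTransition.one_of_one_le hx.le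
    rw [this.deriv_eq, deriv_const]

/-- The derivative of the smooth transition has integral one on `[0, 1]`, so this is an approximate
identity in rescaled form. -/
theorem tendsto_integral_deriv_smoothTransition {V : ℝ → ℝ} (hV : Continuous V) (s : ℝ) :
    Tendsto (fun δ : ℝ => ∫ r in 0..1, deriv Real.smoothTransition r * V (s + δ * r)) (𝓝[>] 0)
      (𝓝 (V s)) := by
  have c1 : Continuous (deriv Real.smoothTransition) :=
    contDiff_smoothTransition.continuous_deriv (by simp)
  have c : Continuous fun δ : ℝ =>
      ∫ r in 0..1, deriv Real.smoothTransition r * V (s + δ * r) := by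
    refine intervalIntegral.continuous_parametric_intervalIntegral_of_continuous' ?_ 0 1
    fun_prop
  have h := (c.tendsto 0).mono_left (nhdsWithin_le_nhds (s := Ioi 0))
  have e : ∫ r in (0 : ℝ)..1, deriv Real.smoothTransition r * V (s + 0 * r) = V s := by
    simp only [zero_mul, add_zero, intervalIntegral.integral_mul_const]
    rw [intervalIntegral.integral_deriv_eq_sub
      (fun x _ => contDiff_smoothTransition.differentiable (by simp) x)
      (c1.intervalIntegrable _ _)]
    simp
  rwa [e] at h

theorem integral_deriv_smoothTransition_scaled {V : ℝ → ℝ} {T s δ : ℝ} (hs : 0 < s) (hδ : 0 < δ)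
    (hsT : s + δ < T) :
    ∫ x in Ioo 0 T, (δ⁻¹ * deriv Real.smoothTransition ((x - s) / δ)) * V x
      = ∫ r in 0..1, deriv Real.smoothTransition r * V (s + δ * r) := by
  have e1 : ∫ x in Ioo 0 T, (δ⁻¹ * deriv Real.smoothTransition ((x - s) / δ)) * V x
      = ∫ x in Icc s (s + δ), (δ⁻¹ * deriv Real.smoothTransition ((x - s) / δ)) * V x := by
    refine setIntegral_eq_of_subset_of_forall_sdiff_eq_zero measurableSet_Ioo
      (fun x hx => ⟨hs.trans_le hx.1, hx.2.trans_lt hsT⟩) fun x hx => ?_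
    rw [deriv_smoothTransition_eq_zero, mul_zero, zero_mul]
    intro h
    refine hx.2 ⟨?_, ?_⟩
    · have := h.1
      rw [le_div_iff₀ hδ] at this
      linarith
    · have := h.2
      rw [div_le_iff₀ hδ] at this
      linarith
  have e2 := intervalIntegral.smul_integral_comp_add_mul
    (fun x => (δ⁻¹ * deriv Real.smoothTransition ((x - s) / δ)) * V x) δ s (a := 0) (b := 1)
  rw [e1, integral_Icc_eq_integral_Ioc, ← intervalIntegral.integral_of_le (by linarith)]
  rw [mul_zero, add_zero, mul_one] at e2
  rw [← e2, ← intervalIntegral.integral_smul]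
  refine intervalIntegral.integral_congr fun r _ => ?_
  have : (s + δ * r - s) / δ = r := by field_simp; ring
  simp only [this, smul_eq_mul]
  field_simp

/-- A smooth approximation of the indicator function of `(s, t]`. -/
def smoothIndicator (s t δ x : ℝ) : ℝ :=
  Real.smoothTransition ((x - s) / δ) - Real.smoothTransition ((x - t) / δ)

theorem isTest_smoothIndicator {s t δ T : ℝ} (hs : 0 < s) (hst : s ≤ t) (hδ : 0 < δ)
    (ht : t + δ < T) : IsTest (Ioo 0 T) (smoothIndicator s t δ) := by
  have sub : tsupport (smoothIndicator s t δ) ⊆ Icc s (t + δ) := by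
    refine closure_minimal (fun x hx => ?_) isClosed_Icc
    by_contra h
    refine hx ?_
    rw [mem_Icc, not_and_or, not_le, not_le] at h
    unfold smoothIndicator
    rcases h with h | h
    · rw [Real.smoothTransition.zero_of_nonpos, Real.smoothTransition.zero_of_nonpos, sub_zero]
      · exact div_nonpos_of_nonpos_of_nonneg (by linarith) hδ.le
      · exact div_nonpos_of_nonpos_of_nonneg (by linarith) hδ.le
    · rw [Real.smoothTransition.one_of_one_le, Real.smoothTransition.one_of_one_le, sub_self]
      · rw [le_div_iff₀ hδ]; linarith
      · rw [le_div_iff₀ hδ]; linarith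
  refine ⟨?_, isCompact_Icc.of_isClosed_subset (isClosed_tsupport _) sub,
    sub.trans fun x hx => ⟨hs.trans_le hx.1, hx.2.trans_lt ht⟩⟩
  have c := contDiff_smoothTransition
  exact (c.comp ((contDiff_id.sub contDiff_const).div_const δ)).sub
    (c.comp ((contDiff_id.sub contDiff_const).div_const δ))

theorem deriv_smoothIndicator (s t δ x : ℝ) :
    deriv (smoothIndicator s t δ) x = δ⁻¹ * deriv Real.smoothTransition ((x - s) / δ)
      - δ⁻¹ * deriv Real.smoothTransition ((x - t) / δ) := by
  have h : ∀ a : ℝ, HasDerivAt (fun y => Real.smoothTransition ((y - a) / δ))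
      (δ⁻¹ * deriv Real.smoothTransition ((x - a) / δ)) x := by
    intro a
    have h1 : HasDerivAt (fun y : ℝ => (y - a) / δ) δ⁻¹ x := by
      simpa using ((hasDerivAt_id x).sub_const a).div_const δ
    have h2 := (contDiff_smoothTransition.differentiable (by simp) ((x - a) / δ)).hasDerivAt
    rw [mul_comm]
    exact h2.comp x h1
  exact ((h s).sub (h t)).deriv

theorem abs_smoothIndicator_le (s t δ x : ℝ) : |smoothIndicator s t δ x| ≤ 1 := by
  have h1 := Real.smoothTransition.nonneg ((x - s) / δ)
  have h2 := Real.smoothTransition.le_one ((x - s) / δ)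
  have h3 := Real.smoothTransition.nonneg ((x - t) / δ)
  have h4 := Real.smoothTransition.le_one ((x - t) / δ)
  rw [smoothIndicator, abs_le]
  constructor <;> linarith

theorem tendsto_smoothTransition_div (y : ℝ) :
    Tendsto (fun δ : ℝ => Real.smoothTransition (y / δ)) (𝓝[>] 0)
      (𝓝 ((Ioi (0 : ℝ)).indicator (fun _ => 1) y)) := by
  rcases le_or_gt y 0 with h | h
  · rw [indicator_of_notMem (by simpa using h)]
    refine tendsto_const_nhds.congr' ?_
    filter_upwards [self_mem_nhdsWithin] with δ hδ
    exact (Real.smoothTransition.zero_of_nonpos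
      (div_nonpos_of_nonpos_of_nonneg h (le_of_lt hδ))).symm
  · rw [indicator_of_mem (by simpa using h)]
    refine tendsto_const_nhds.congr' ?_
    filter_upwards [self_mem_nhdsWithin, (eventually_le_nhds h).filter_mono nhdsWithin_le_nhds]
      with δ hδ h'
    refine (Real.smoothTransition.one_of_one_le ?_).symm
    rw [le_div_iff₀ hδ]; linarith

/-- Test with `smoothIndicator s t δ` and let `δ → 0`: dominated convergence gives the integral of
`k`, while the differentiated test function concentrates at `s` and `t`. -/
theorem intervalIntegral_eq_sub_of_distributional_of_mem_Ioo {T : ℝ} {k V : ℝ → ℝ}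
    (hk : IntegrableOn k (Ioo 0 T)) (hV : Continuous V)
    (h : ∀ θ : ℝ → ℝ, IsTest (Ioo 0 T) θ →
      ∫ t in Ioo 0 T, θ t * k t = - ∫ t in Ioo 0 T, deriv θ t * V t) {s t : ℝ} (hs : 0 < s)
    (hst : s ≤ t) (ht : t < T) : ∫ τ in s..t, k τ = V t - V s := by
  have ev : ∀ᶠ δ : ℝ in 𝓝[>] 0, 0 < δ ∧ δ < T - t :=
    eventually_mem_nhdsWithin.and
      ((eventually_lt_nhds (sub_pos.2 ht)).filter_mono nhdsWithin_le_nhds)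
  have lim1 : Tendsto (fun δ => ∫ x in Ioo 0 T, smoothIndicator s t δ x * k x) (𝓝[>] 0)
      (𝓝 (∫ τ in s..t, k τ)) := by
    have e : ∫ τ in s..t, k τ = ∫ x in Ioo 0 T, ((Ioi (0 : ℝ)).indicator (fun _ => 1) (x - s)
        - (Ioi (0 : ℝ)).indicator (fun _ => 1) (x - t)) * k x := by
      rw [intervalIntegral.integral_of_le hst]
      have : ∀ x, ((Ioi (0 : ℝ)).indicator (fun _ => (1 : ℝ)) (x - s)
          - (Ioi (0 : ℝ)).indicator (fun _ => 1) (x - t)) * k x = (Ioc s t).indicator k x := by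
        intro x
        by_cases h1 : s < x
        · by_cases h2 : t < x
          · simp [h1, h2, indicator]
          · simp [h1, h2, indicator, not_lt.1 h2]
        · have h2 : ¬ t < x := fun h' => h1 (hst.trans_lt h')
          simp [h1, h2, indicator]
      simp only [this]
      rw [setIntegral_indicator measurableSet_Ioc, inter_eq_self_of_subset_right]
      exact fun x hx => ⟨hs.trans hx.1, hx.2.trans_lt ht⟩
    rw [e]
    have sc := contDiff_smoothTransition.continuous
    refine tendsto_integral_filter_of_dominated_convergence (fun x => |k x|)
      (Eventually.of_forall fun δ => ?_) (Eventually.of_forall fun δ =>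
        Eventually.of_forall fun x => ?_) hk.abs (Eventually.of_forall fun x => ?_)
    · have : Continuous (smoothIndicator s t δ) := by unfold smoothIndicator; fun_prop
      exact this.aestronglyMeasurable.mul hk.aestronglyMeasurable
    · rw [Real.norm_eq_abs, abs_mul]
      exact mul_le_of_le_one_left (abs_nonneg _) (abs_smoothIndicator_le _ _ _ _)
    · exact ((tendsto_smoothTransition_div (x - s)).sub
        (tendsto_smoothTransition_div (x - t))).mul_const _
  have lim2 : Tendsto (fun δ => ∫ x in Ioo 0 T, smoothIndicator s t δ x * k x) (𝓝[>] 0)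
      (𝓝 (V t - V s)) := by
    refine ((tendsto_integral_deriv_smoothTransition hV t).sub
      (tendsto_integral_deriv_smoothTransition hV s)).congr' ?_
    filter_upwards [ev] with δ hδ
    rw [h _ (isTest_smoothIndicator hs hst hδ.1 (by linarith)),
      ← integral_deriv_smoothTransition_scaled (T := T) hs hδ.1 (by linarith),
      ← integral_deriv_smoothTransition_scaled (T := T) (hs.trans_le hst) hδ.1 (by linarith)]
    have c1 : Continuous (deriv Real.smoothTransition) :=
      contDiff_smoothTransition.continuous_deriv (by simp)
    have int : ∀ a, IntegrableOn
        (fun x => (δ⁻¹ * deriv Real.smoothTransition ((x - a) / δ)) * V x) (Ioo 0 T) := by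
      intro a
      have : Continuous (fun x => (δ⁻¹ * deriv Real.smoothTransition ((x - a) / δ)) * V x) := by
        fun_prop
      exact (this.continuousOn.integrableOn_Icc (a := 0) (b := T)).mono_set Ioo_subset_Icc_self
    simp only [deriv_smoothIndicator, sub_mul]
    rw [integral_sub (int s) (int t)]
    ring
  exact tendsto_nhds_unique lim1 lim2

/-- If `U` is continuous on `[0, T]` with integrable distributional derivative `k`, then
`U t - U s = ∫_s^t k`. -/
theorem intervalIntegral_eq_sub_of_distributional {T : ℝ} (hT : 0 < T) {k U : ℝ → ℝ}
    (hk : IntegrableOn k (Ioo 0 T)) (hU : ContinuousOn U (Icc 0 T))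
    (h : ∀ θ : ℝ → ℝ, IsTest (Ioo 0 T) θ →
      ∫ t in Ioo 0 T, θ t * k t = - ∫ t in Ioo 0 T, deriv θ t * U t) {s t : ℝ}
    (hs : s ∈ Icc 0 T) (ht : t ∈ Icc 0 T) : ∫ τ in s..t, k τ = U t - U s := by
  have hk' : IntervalIntegrable k volume 0 T :=
    (intervalIntegrable_iff_integrableOn_Ioo_of_le hT.le).2 hk
  have ki : ∀ a ∈ Icc 0 T, ∀ c ∈ Icc 0 T, IntervalIntegrable k volume a c := by
    intro a ha c hc
    refine hk'.mono_set ?_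
    rw [uIcc_of_le hT.le]
    exact uIcc_subset_Icc ha hc
  have V1 : Continuous (IccExtend hT.le ((Icc 0 T).domRestrict U)) :=
    (continuousOn_iff_continuous_domRestrict.1 hU).Icc_extend'
  have V2 : ∀ x ∈ Icc 0 T, IccExtend hT.le ((Icc 0 T).domRestrict U) x = U x := fun x hx =>
    IccExtend_of_mem _ _ hx
  have h' : ∀ θ : ℝ → ℝ, IsTest (Ioo 0 T) θ → ∫ t in Ioo 0 T, θ t * k t =
      - ∫ t in Ioo 0 T, deriv θ t * IccExtend hT.le ((Icc 0 T).domRestrict U) t := by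
    intro θ hθ
    rw [h θ hθ]
    congr 1
    refine setIntegral_congr_fun measurableSet_Ioo fun x hx => ?_
    simp only [V2 x (Ioo_subset_Icc_self hx)]
  have inner : ∀ t ∈ Ioo 0 T, ∫ τ in (T / 2)..t, k τ = U t - U (T / 2) := by
    intro t ht
    have hm : T / 2 ∈ Ioo 0 T := ⟨by linarith, by linarith⟩
    rw [← V2 _ (Ioo_subset_Icc_self ht), ← V2 _ (Ioo_subset_Icc_self hm)]
    rcases le_total (T / 2) t with hl | hl
    · exact intervalIntegral_eq_sub_of_distributional_of_mem_Ioo hk V1 h' hm.1 hl ht.2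
    · rw [intervalIntegral.integral_symm,
        intervalIntegral_eq_sub_of_distributional_of_mem_Ioo hk V1 h' ht.1 hl hm.2]
      ring
  have hm : T / 2 ∈ Icc 0 T := ⟨by linarith, by linarith⟩
  -- Both sides are continuous on `[0, T]` and agree on the dense open interval; the interior base
  -- point `T / 2` lets both end points be reached this way.
  have ext : EqOn (fun t => ∫ τ in (T / 2)..t, k τ) (fun t => U t - U (T / 2)) (Icc 0 T) := by
    refine EqOn.of_subset_closure (s := Ioo 0 T) inner ?_ (hU.sub continuousOn_const)
      Ioo_subset_Icc_self (by rw [closure_Ioo hT.ne])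
    have := intervalIntegral.continuousOn_primitive_interval' hk'
      (by rw [uIcc_of_le hT.le]; exact hm)
    rwa [uIcc_of_le hT.le] at this
  have e := intervalIntegral.integral_interval_sub_left (ki _ hm t ht) (ki _ hm s hs)
  rw [← e]
  have e1 := ext ht
  have e2 := ext hs
  simp only at e1 e2
  rw [e1, e2]
  ring

/-! ### Weak continuity and duality in `L^{m+1}` -/

section Duality

variable {α : Type*} [MeasurableSpace α] {μ : Measure α} {m : ℝ}

/-- The exponent is `(m + 1) / m`, conjugate to `m + 1`, and it is the one to which `β(v)` belongs.
-/
theorem exists_dual_eq_integral (hm : 0 < m) {h : α → ℝ}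
    (hh : MemLp h (expo m / ENNReal.ofReal m) μ) :
    ∃ ℓ : StrongDual ℝ (Lp ℝ (expo m) μ), ∀ v, ℓ v = ∫ x, h x * v x ∂μ := by
  have m0 : ENNReal.ofReal m ≠ 0 := by simpa using hm
  have mt : ENNReal.ofReal m ≠ ⊤ := ENNReal.ofReal_ne_top
  have conj : ENNReal.HolderConjugate (expo m / ENNReal.ofReal m) (expo m) := by
    refine ⟨?_⟩
    rw [ENNReal.inv_div (Or.inl mt) (Or.inl m0), ENNReal.div_eq_inv_mul, inv_one]
    nth_rw 2 [← mul_one (expo m)⁻¹]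
    rw [← mul_add]
    exact ENNReal.inv_mul_cancel expo_ne_zero expo_ne_top
  have one : Fact (1 ≤ expo m / ENNReal.ofReal m) := by
    refine ⟨?_⟩
    rw [ENNReal.le_div_iff_mul_le (Or.inl m0) (Or.inl mt), one_mul]
    exact le_self_add
  refine ⟨(ContinuousLinearMap.mul ℝ ℝ).lpPairing μ _ _ (hh.toLp h), fun v => ?_⟩
  rw [ContinuousLinearMap.lpPairing_eq_integral]
  refine integral_congr_ae ?_
  filter_upwards [hh.coeFn_toLp] with x hx
  rw [hx]; rfl

theorem memLp_beta (hm : 0 < m) (v : Lp ℝ (expo m) μ) :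
    MemLp (fun x => beta m (v x)) (expo m / ENNReal.ofReal m) μ := by
  have h := (Lp.memLp v).norm_rpow_div (ENNReal.ofReal m)
  rw [ENNReal.toReal_ofReal hm.le] at h
  refine h.of_le ((continuous_beta hm).comp_aestronglyMeasurable (Lp.aestronglyMeasurable v))
    (Eventually.of_forall fun x => ?_)
  rw [Real.norm_eq_abs, abs_beta hm]
  exact le_abs_self _

end Duality

section WeakCont

variable {d : ℕ} {Ω : Set (Space d)} {T m : ℝ} {u : ℝ → LSpace Ω m}

theorem IsWeaklyContinuous.continuousOn_integral (hu : IsWeaklyContinuous Ω T m u) (hm : 0 < m)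
    {h : Space d → ℝ} (hh : MemLp h (expo m / ENNReal.ofReal m) (volume.restrict Ω)) :
    ContinuousOn (fun t => ∫ x in Ω, h x * u t x) (Icc 0 T) := by
  obtain ⟨ℓ, hℓ⟩ := exists_dual_eq_integral hm hh
  simp only [← hℓ]
  exact (WeakBilin.eval_continuous (topDualPairing ℝ (LSpace Ω m)).flip ℓ).comp_continuousOn hu

/-- An element of `H^{-1}(Ω)` as a continuous linear form on `H^1_0(Ω)`. -/
def HNeg1.toDual (g : HNeg1 Ω) : StrongDual ℝ (H10 Ω) := g

theorem IsTimeDerivOf.memLp_toDual {g : ℝ → HNeg1 Ω} (hg : IsTimeDerivOf Ω T m u g) :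
    MemLp (fun τ => (g τ).toDual) 2 (volume.restrict (Ioo 0 T)) := hg.memLp

theorem IsTimeDerivOf.intervalIntegral_apply {g : ℝ → HNeg1 Ω} (hg : IsTimeDerivOf Ω T m u g)
    (hu : IsWeaklyContinuous Ω T m u) (hT : 0 < T) (hm : 0 < m)
    [IsFiniteMeasure (volume.restrict Ω)] {s t : ℝ} (hs : s ∈ Icc 0 T) (ht : t ∈ Icc 0 T)
    {ψ : Space d → ℝ} (hψ : IsTest Ω ψ) :
    (∫ τ in s..t, (g τ).toDual) (H10.ofTest ψ hψ)
      = ∫ x in Ω, (u t x - u s x) * ψ x := by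
  have gi : IntegrableOn (fun τ => (g τ).toDual) (Ioo 0 T) :=
    hg.memLp_toDual.integrable (by norm_num)
  have gi' : IntervalIntegrable (fun τ => (g τ).toDual) volume s t := by
    refine IntervalIntegrable.mono_set
      ((intervalIntegrable_iff_integrableOn_Ioo_of_le hT.le).2 gi) ?_
    rw [uIcc_of_le hT.le]
    exact uIcc_subset_Icc hs ht
  have ψq : MemLp ψ (expo m / ENNReal.ofReal m) (volume.restrict Ω) :=
    hψ.smooth.continuous.memLp_of_hasCompactSupport hψ.compact
  have c : ContinuousOn (fun t => ∫ x in Ω, u t x * ψ x) (Icc 0 T) := by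
    refine (hu.continuousOn_integral hm ψq).congr fun t _ => ?_
    simp only [mul_comm]
  rw [ContinuousLinearMap.intervalIntegral_apply gi',
    intervalIntegral_eq_sub_of_distributional hT
      (k := fun τ => (g τ).toDual (H10.ofTest ψ hψ))
      (ContinuousLinearMap.integrable_comp
        (ContinuousLinearMap.apply ℝ ℝ (H10.ofTest ψ hψ)) gi) c
      (fun θ hθ => hg.eq θ ψ hθ hψ) hs ht]
  have ui : ∀ r, IntegrableOn (fun x => u r x * ψ x) Ω := fun r =>
    hψ.integrable_mul ((Lp.memLp (u r)).integrable Fact.out)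
  simp only [sub_mul]
  rw [integral_sub (ui t) (ui s)]

end WeakCont

/-! ### The energy of a weak solution -/

section Energy

variable {d : ℕ} {Ω : Set (Space d)} {T m : ℝ} {u : ℝ → LSpace Ω m}

/-- Convexity bounds the energy at `s` below by its affine minorant at `u t`, which is weakly
continuous because `β(u t)` lies in the dual space. -/
theorem IsWeaklyContinuous.eventually_energy_ge (hu : IsWeaklyContinuous Ω T m u) (hm : 0 < m)
    {t : ℝ} (ht : t ∈ Icc 0 T) {ε : ℝ} (hε : 0 < ε) :
    ∀ᶠ s in 𝓝[Icc 0 T] t,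
      (∫ x in Ω, zeta m (u t x)) - ε ≤ ∫ x in Ω, zeta m (u s x) := by
  have c := hu.continuousOn_integral hm (memLp_beta hm (u t)) t ht
  have ev := c.eventually (eventually_gt_nhds (sub_lt_self _ hε))
  filter_upwards [ev] with s hs
  have h1 : 0 ≤ ∫ x in Ω, bregman m (u s x) (u t x) :=
    integral_nonneg fun x => bregman_nonneg hm _ _
  rw [integral_bregman hm] at h1
  linarith

theorem IsZetaOf.integrableOn_energy {z : ℝ → Lp ℝ 1 (volume.restrict Ω)}
    (hz : IsZetaOf Ω T m u z) :
    IntegrableOn (fun t => ∫ x in Ω, zeta m (u t x)) (Ioo 0 T) := by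
  have h1 : Integrable z (volume.restrict (Ioo 0 T)) := hz.memLp.integrable le_top
  refine (ContinuousLinearMap.integrable_comp (L1.integralCLM (α := Space d) (E := ℝ)
    (μ := volume.restrict Ω)) h1).congr ?_
  filter_upwards [hz.eq] with t ht
  have e : L1.integralCLM (z t) = ∫ x in Ω, z t x := by
    rw [← L1.integral_eq, L1.integral_eq_integral]
  rw [e]
  exact integral_congr_ae ht

/-- The increment of `u` represents the integrated derivative on test functions, and its product
with `β(u s)` is integrable, so the pairing is an integral. Nonnegativity of the Bregman distance is
then the subdifferential inequality. -/
theorem IsTimeDerivOf.intervalIntegral_apply_le {g : ℝ → HNeg1 Ω} (hg : IsTimeDerivOf Ω T m u g)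
    (hu : IsWeaklyContinuous Ω T m u) (hΩ : IsOpen Ω) (hT : 0 < T) (hm : 0 < m)
    [IsFiniteMeasure (volume.restrict Ω)] {s t : ℝ} (hs : s ∈ Icc 0 T) (ht : t ∈ Icc 0 T)
    {w : H10 Ω} (hw : w.fn =ᵐ[volume.restrict Ω] fun x => beta m (u s x)) :
    (∫ τ in s..t, (g τ).toDual) w
      ≤ (∫ x in Ω, zeta m (u t x)) - ∫ x in Ω, zeta m (u s x) := by
  have iu : ∀ r, IntegrableOn (u r) Ω := fun r => (Lp.memLp (u r)).integrable Fact.out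
  have ib : IntegrableOn (fun x => beta m (u s x) * u t x - beta m (u s x) * u s x) Ω :=
    (integrable_beta_mul hm _ _).sub (integrable_beta_mul hm _ _)
  have ae : (fun x => beta m (u s x) * u t x - beta m (u s x) * u s x)
      =ᵐ[volume.restrict Ω] fun x => (u t x - u s x) * w.fn x := by
    filter_upwards [hw] with x hx
    rw [hx]; ring
  rw [dual_apply_eq_integral hΩ ((iu t).sub (iu s)) _
    (fun ψ hψ => hg.intervalIntegral_apply hu hT hm hs ht hψ) w (ib.congr ae)]
  have e : ∫ x in Ω, (u t - u s : Space d → ℝ) x * w.fn x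
      = (∫ x in Ω, beta m (u s x) * u t x) - ∫ x in Ω, beta m (u s x) * u s x := by
    rw [← integral_sub (integrable_beta_mul hm _ _) (integrable_beta_mul hm _ _)]
    exact (integral_congr_ae ae).symm
  rw [e]
  have h1 : 0 ≤ ∫ x in Ω, bregman m (u t x) (u s x) :=
    integral_nonneg fun x => bregman_nonneg hm _ _
  rw [integral_bregman hm] at h1
  linarith

theorem energy_sub_eq_integral_pairing {g : ℝ → HNeg1 Ω} (hg : IsTimeDerivOf Ω T m u g)
    {b : ℝ → H10 Ω} (hb : IsBetaOf Ω T m u b) {z : ℝ → Lp ℝ 1 (volume.restrict Ω)}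
    (hz : IsZetaOf Ω T m u z) (hu : IsWeaklyContinuous Ω T m u) (hΩ : IsOpen Ω) (hm : 0 < m)
    [IsFiniteMeasure (volume.restrict Ω)] {T₀ : ℝ} (h0 : 0 < T₀) (hT₀ : T₀ ≤ T) :
    (∫ x in Ω, zeta m (u T₀ x)) - (∫ x in Ω, zeta m (u 0 x))
      = ∫ t in Ioo 0 T₀, (g t).toDual (b t) := by
  have hT : 0 < T := h0.trans_le hT₀
  have sub : Ioo 0 T₀ ⊆ Ioo 0 T := Ioo_subset_Ioo_right hT₀
  have le := Measure.restrict_mono_set (volume : Measure ℝ) sub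
  refine energy_identity_of_subdifferential h0 (hg.memLp_toDual.mono_measure le)
    (hb.memLp.mono_measure le) (E := fun t => ∫ x in Ω, zeta m (u t x))
    (hz.integrableOn_energy.mono_set sub) (fun ε hε => ?_) (fun ε hε => ?_) ?_
  · refine (hu.eventually_energy_ge hm ⟨le_rfl, hT.le⟩ hε).filter_mono ?_
    exact nhdsWithin_le_of_mem (Icc_mem_nhdsGT hT)
  · refine (hu.eventually_energy_ge hm ⟨h0.le, hT₀⟩ hε).filter_mono ?_
    exact nhdsWithin_le_of_mem (mem_of_superset (Icc_mem_nhdsLT h0) (Icc_subset_Icc_right hT₀))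
  · filter_upwards [ae_mono le hb.eq, ae_restrict_mem measurableSet_Ioo] with t h1 ht s hs
    exact hg.intervalIntegral_apply_le hu hΩ hT hm (Ioo_subset_Icc_self (sub ht))
      (Icc_subset_Icc_right hT₀ hs) h1

theorem IsBetaOf.ae_weakGrad {b : ℝ → H10 Ω} (hb : IsBetaOf Ω T m u b) (hΩ : IsOpen Ω) :
    ∀ᵐ t ∂(volume.restrict (Ioo 0 T)),
      weakGrad Ω (fun y => beta m (u t y)) =ᵐ[volume.restrict Ω] (b t).grad := by
  filter_upwards [hb.eq] with t ht
  exact weakGrad_ae_eq hΩ _ ht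

theorem IsBetaOf.ae_inner_eq {b : ℝ → H10 Ω} (hb : IsBetaOf Ω T m u b) (hΩ : IsOpen Ω)
    (hm : 0 < m) (Λ : Space d → ℝ → (Space d →L[ℝ] Space d)) :
    ∀ᵐ t ∂(volume.restrict (Ioo 0 T)),
      (fun x => inner ℝ (Λ x (u t x) (weakGrad Ω (fun y => beta m (u t y)) x))
        (weakGrad Ω (fun y => beta m (u t y)) x)) =ᵐ[volume.restrict Ω]
      fun x => inner ℝ (Λ x (beta m⁻¹ ((b t).fn x)) ((b t).grad x)) ((b t).grad x) := by
  filter_upwards [hb.ae_weakGrad hΩ, hb.eq] with t h1 h2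
  filter_upwards [h1, h2] with x e1 e2
  rw [e1, e2, beta_inv_beta hm]

theorem IsBetaOf.ae_dissipation_eq {b : ℝ → H10 Ω} (hb : IsBetaOf Ω T m u b) (hΩ : IsOpen Ω)
    (hm : 0 < m) (Λ : Space d → ℝ → (Space d →L[ℝ] Space d)) :
    ∀ᵐ t ∂(volume.restrict (Ioo 0 T)),
      dissipation Ω m Λ (u t) = quadForm Ω m Λ (b t).fn (b t).grad := by
  filter_upwards [hb.ae_inner_eq hΩ hm Λ] with t ht
  exact integral_congr_ae ht

theorem IsBetaOf.memLp_fn {b : ℝ → H10 Ω} (hb : IsBetaOf Ω T m u b) :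
    MemLp (fun t => (b t).fn) 2 (volume.restrict (Ioo 0 T)) :=
  H10.fnL.comp_memLp' hb.memLp

/-- The weak formulation tested with `β(u)` on the time interval `(0, T₀)`. -/
theorem integral_pairing_eq {Λ : Space d → ℝ → (Space d →L[ℝ] Space d)}
    {f : ℝ → Space d → ℝ} {g : ℝ → HNeg1 Ω} {b : ℝ → H10 Ω} (hb : IsBetaOf Ω T m u b)
    (hΩ : IsOpen Ω)
    (weak : ∀ φ : ℝ → H10 Ω, MemLp φ 2 (volume.restrict (Ioo 0 T)) →
      (∫ t in Ioo 0 T, (g t).pair (φ t))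
        + (∫ t in Ioo 0 T, ∫ x in Ω, inner ℝ
            (Λ x (u t x) (weakGrad Ω (fun y => beta m (u t y)) x)) ((φ t).grad x))
      = ∫ t in Ioo 0 T, ∫ x in Ω, f t x * (φ t).fn x) {T₀ : ℝ} (hT₀ : T₀ ≤ T) :
    (∫ t in Ioo 0 T₀, (g t).toDual (b t)) + ∫ t in Ioo 0 T₀, dissipation Ω m Λ (u t)
      = ∫ t in Ioo 0 T₀, ∫ x in Ω, f t x * beta m (u t x) := by
  have sub : Ioo 0 T₀ ⊆ Ioo 0 T := Ioo_subset_Ioo_right hT₀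
  have red : ∀ k : ℝ → ℝ, ∫ t in Ioo 0 T, (Ioo 0 T₀).indicator k t = ∫ t in Ioo 0 T₀, k t := by
    intro k
    rw [setIntegral_indicator measurableSet_Ioo, inter_eq_self_of_subset_right sub]
  -- A time cut-off of `b` remains admissible, since test curves need no regularity in time.
  have h := weak ((Ioo 0 T₀).indicator b) (hb.memLp.indicator measurableSet_Ioo)
  have e1 : ∫ t in Ioo 0 T, (g t).pair ((Ioo 0 T₀).indicator b t)
      = ∫ t in Ioo 0 T₀, (g t).toDual (b t) := by
    rw [← red]
    refine integral_congr_ae (Eventually.of_forall fun t => ?_)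
    by_cases ht : t ∈ Ioo 0 T₀
    · simp only [indicator_of_mem ht]; rfl
    · simp only [indicator_of_notMem ht]
      exact map_zero (g t).toDual
  have z1 : ((0 : H10 Ω).grad : Space d → Space d) =ᵐ[volume.restrict Ω] 0 :=
    Lp.coeFn_zero _ _ _
  have z2 : ((0 : H10 Ω).fn : Space d → ℝ) =ᵐ[volume.restrict Ω] 0 :=
    Lp.coeFn_zero _ _ _
  have e2 : (∫ t in Ioo 0 T, ∫ x in Ω, inner ℝ
        (Λ x (u t x) (weakGrad Ω (fun y => beta m (u t y)) x))
        (((Ioo 0 T₀).indicator b t).grad x))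
      = ∫ t in Ioo 0 T₀, dissipation Ω m Λ (u t) := by
    rw [← red]
    refine integral_congr_ae ?_
    filter_upwards [hb.ae_weakGrad hΩ] with t h1
    by_cases ht : t ∈ Ioo 0 T₀
    · simp only [indicator_of_mem ht]
      refine integral_congr_ae ?_
      filter_upwards [h1] with x hx
      rw [hx]
    · simp only [indicator_of_notMem ht]
      rw [← integral_zero (Space d) ℝ (μ := volume.restrict Ω)]
      refine integral_congr_ae ?_
      filter_upwards [z1] with x hx
      rw [hx]; simp
  have e3 : (∫ t in Ioo 0 T, ∫ x in Ω, f t x * ((Ioo 0 T₀).indicator b t).fn x)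
      = ∫ t in Ioo 0 T₀, ∫ x in Ω, f t x * beta m (u t x) := by
    rw [← red]
    refine integral_congr_ae ?_
    filter_upwards [hb.eq] with t h1
    by_cases ht : t ∈ Ioo 0 T₀
    · simp only [indicator_of_mem ht]
      refine integral_congr_ae ?_
      filter_upwards [h1] with x hx
      rw [hx]
    · simp only [indicator_of_notMem ht]
      rw [← integral_zero (Space d) ℝ (μ := volume.restrict Ω)]
      refine integral_congr_ae ?_
      filter_upwards [z2] with x hx
      rw [hx]; simp
  rwa [e1, e2, e3] at h

end Energy

end PorousMedium

end

/-! ### Energy equality and strong continuity of weak solutions. -/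

theorem mainTheorem3 {d : ℕ} (hd : 1 ≤ d) (Ω : Set (EuclideanSpace ℝ (Fin d)))
    (hΩo : IsOpen Ω) (hΩb : Bornology.IsBounded Ω) (T : ℝ) (hT : 0 < T) (m : ℝ) (hm : 0 < m)
    (Λ : EuclideanSpace ℝ (Fin d) → ℝ →
      (EuclideanSpace ℝ (Fin d) →L[ℝ] EuclideanSpace ℝ (Fin d)))
    (hΛ : PorousMedium.IsDiffusionTensor Ω Λ)
    (f : ℝ → EuclideanSpace ℝ (Fin d) → ℝ)
    (hf : MemLp (Function.uncurry f) 2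
      ((volume : Measure (ℝ × EuclideanSpace ℝ (Fin d))).restrict (Ioo 0 T ×ˢ Ω)))
    (u₀ : PorousMedium.LSpace Ω m) (u : ℝ → PorousMedium.LSpace Ω m)
    (hu : PorousMedium.IsWeakSolution Ω T m Λ f u₀ u) :
    -- all the integrals below exist
    ((∀ t ∈ Icc 0 T, IntegrableOn (fun x => PorousMedium.zeta m (u t x)) Ω) ∧
      (∀ᵐ t ∂(volume.restrict (Ioo 0 T)), IntegrableOn
        (fun x => inner ℝ
          (Λ x (u t x) (PorousMedium.weakGrad Ω (fun y => PorousMedium.beta m (u t y)) x))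
          (PorousMedium.weakGrad Ω (fun y => PorousMedium.beta m (u t y)) x)) Ω) ∧
      (∀ᵐ t ∂(volume.restrict (Ioo 0 T)),
        IntegrableOn (fun x => f t x * PorousMedium.beta m (u t x)) Ω) ∧
      IntervalIntegrable (fun t => PorousMedium.dissipation Ω m Λ (u t)) volume 0 T ∧
      IntervalIntegrable (fun t => ∫ x in Ω, f t x * PorousMedium.beta m (u t x)) volume 0 T) ∧
    -- the energy equality
    (∀ T₀ ∈ Icc 0 T,
      (∫ x in Ω, PorousMedium.zeta m (u T₀ x))
          + (∫ t in (0 : ℝ)..T₀, PorousMedium.dissipation Ω m Λ (u t))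
        = (∫ x in Ω, PorousMedium.zeta m (u₀ x))
          + ∫ t in (0 : ℝ)..T₀, ∫ x in Ω, f t x * PorousMedium.beta m (u t x)) ∧
    -- continuity and boundedness of the energy
    (ContinuousOn (fun t => ∫ x in Ω, PorousMedium.zeta m (u t x)) (Icc 0 T) ∧
      ∃ C : ℝ, ∀ t ∈ Icc 0 T, |∫ x in Ω, PorousMedium.zeta m (u t x)| ≤ C) ∧
    -- continuity for the strong topology of `L^{m+1}(Ω)`
    ContinuousOn u (Icc 0 T) := by
  have : Fact (volume Ω < ⊤) := ⟨hΩb.measure_lt_top⟩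
  have hΩm := hΩo.measurableSet
  obtain ⟨b, hb⟩ := hu.beta_mem
  obtain ⟨z, hz⟩ := hu.zeta_mem
  obtain ⟨g, hg, weak⟩ := hu.weak_eq
  have hf' := PorousMedium.memLp_prod_of_memLp_restrict hf
  have int_diss : IntervalIntegrable (fun t => PorousMedium.dissipation Ω m Λ (u t)) volume 0 T := by
    rw [intervalIntegrable_iff_integrableOn_Ioo_of_le hT.le]
    refine (hΛ.integrable_quadForm hΩm hm hb.memLp).congr ?_
    filter_upwards [hb.ae_dissipation_eq hΩo hm Λ] with t ht
    exact ht.symm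
  have int_f : IntervalIntegrable (fun t => ∫ x in Ω, f t x * PorousMedium.beta m (u t x))
      volume 0 T := by
    rw [intervalIntegrable_iff_integrableOn_Ioo_of_le hT.le]
    refine (PorousMedium.integrable_integral_mul hf' hb.memLp_fn).congr ?_
    filter_upwards [hb.eq] with t ht
    refine integral_congr_ae ?_
    filter_upwards [ht] with x hx
    rw [hx]
  have energy : ∀ T₀ ∈ Icc 0 T,
      (∫ x in Ω, PorousMedium.zeta m (u T₀ x))
          + (∫ t in (0 : ℝ)..T₀, PorousMedium.dissipation Ω m Λ (u t))
        = (∫ x in Ω, PorousMedium.zeta m (u₀ x))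
          + ∫ t in (0 : ℝ)..T₀, ∫ x in Ω, f t x * PorousMedium.beta m (u t x) := by
    intro T₀ hT₀
    rw [← hu.init]
    rcases hT₀.1.eq_or_lt with h0 | h0
    · rw [← h0]; simp
    · have k1 := PorousMedium.energy_sub_eq_integral_pairing hg hb hz hu.weakCont hΩo hm h0 hT₀.2
      have k2 := PorousMedium.integral_pairing_eq hb hΩo weak hT₀.2
      rw [intervalIntegral.integral_of_le h0.le, intervalIntegral.integral_of_le h0.le,
        integral_Ioc_eq_integral_Ioo, integral_Ioc_eq_integral_Ioo]
      linarith
  have cont : ContinuousOn (fun t => ∫ x in Ω, PorousMedium.zeta m (u t x)) (Icc 0 T) := by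
    have c1 := intervalIntegral.continuousOn_primitive_interval' int_diss left_mem_uIcc
    have c2 := intervalIntegral.continuousOn_primitive_interval' int_f left_mem_uIcc
    rw [uIcc_of_le hT.le] at c1 c2
    -- The energy equality expresses the energy as a constant plus primitives of integrable
    -- functions.
    refine ((continuousOn_const (c := ∫ x in Ω, PorousMedium.zeta m (u₀ x))).add
      (c2.sub c1)).congr fun t ht => ?_
    have := energy t ht
    simp only [Pi.add_apply, Pi.sub_apply]
    linarith
  refine ⟨⟨fun t _ => PorousMedium.integrable_zeta hm (u t), ?_, ?_, int_diss, int_f⟩, energy,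
    ⟨cont, isCompact_Icc.exists_bound_of_continuousOn cont⟩, fun t ht => ?_⟩
  · obtain ⟨M, hM⟩ := hΛ.exists_bound hΩm
    filter_upwards [hb.ae_inner_eq hΩo hm Λ] with t ht
    refine Integrable.congr (hΛ.integrable_inner hΩm ?_ hM (b t).grad).1 ht.symm
    exact (PorousMedium.continuous_beta (inv_pos.2 hm)).comp_aestronglyMeasurable
      (Lp.aestronglyMeasurable (b t).fn)
  · filter_upwards [hb.eq, PorousMedium.ae_memLp_slice hf'] with t h1 h2
    have h3 : Integrable (fun x => f t x * (b t).fn x) (volume.restrict Ω) :=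
      memLp_one_iff_integrable.1 ((Lp.memLp (b t).fn).mul h2)
    refine h3.congr ?_
    filter_upwards [h1] with x hx
    rw [hx]
  -- Convergence of energies and weak continuity tested against `β(u t)` are exactly what the
  -- Radon–Riesz argument needs.
  · exact PorousMedium.tendsto_of_tendsto_integral_zeta hm (cont t ht)
      (hu.weakCont.continuousOn_integral hm (PorousMedium.memLp_beta hm (u t)) t ht)
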